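/- Let $\Omega\subset\mathbb{R}^3$ be a bounded domain (non-empty, open, connected) with Lipschitz boundary; that is, $\partial\Omega$ is covered by finitely many open sets $U_1,\dots,U_M$ such that each $\overline{U_i}\cap\overline\Omega$ is the image of the closed half ball $\{|y|\le 1,\ y_3\ge 0\}$ under a bi-Lipschitz homeomorphism which maps the flat face $\{|y|\le1,\ y_3=0\}$ onto $\overline{U_i}\cap\partial\Omega$. For integers $k\ge 0$ and $1\le p\le\infty$, let $W^{k,p}(\Omega)$ be the Sobolev space of real functions in $L^p(\Omega)$ whose weak derivatives of all orders up to $k$ are in $L^p(\Omega)$, let $H^k(\Omega)=W^{k,2}(\Omega)$, and let $H^k(\Omega)^{3\times3}$ be the space of $3\times 3$ matrix fields with all entries in $H^k(\Omega)$. Let $m\ge 2$ be an integer and let $\mathsf{B}\in H^m(\Omega)^{3\times3}$ satisfy $\det\mathsf{B}=1$ almost everywhere on $\Omega$. Then the pointwise inverse satisfies $\mathsf{B}^{-1}\in H^m(\Omega)^{3\times3}$. If, moreover, $\mu_1,\mu_2,\mu_3\in W^{1,\infty}(\Omega)\cap H^m(\Omega)$ are scalar fields, then $$\mathcal{A}(\mathsf{B})=\mu_1\mathsf{I}+\mu_2\mathsf{B}+\mu_3\mathsf{B}^{-1}\in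 H^m(\Omega)^{3\times3}.$$ -/

import Mathlib

open MeasureTheory
open scoped ENNReal NNReal

noncomputable section

namespace Visco

/-- Three-dimensional Euclidean space. -/
abbrev R3 : Type := EuclideanSpace ℝ (Fin 3)

/-- A tensor field on `R3`, i.e. a field of real `3 × 3` matrices. -/
abbrev TensorField : Type := R3 → Matrix (Fin 3) (Fin 3) ℝ

/-- The classical partial derivative `∂φ/∂xᵢ`. -/
def partialDeriv (i : Fin 3) (φ : R3 → ℝ) : R3 → ℝ :=
  fun x => fderiv ℝ φ x (EuclideanSpace.single i 1)

/-- The order `|γ| = γ₁ + γ₂ + γ₃` of a multi-index. -/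
def multiOrder (γ : Fin 3 → ℕ) : ℕ := ∑ i, γ i

/-- The classical derivative `D^γ φ = ∂₁^γ₁ ∂₂^γ₂ ∂₃^γ₃ φ`. -/
def multiDeriv (γ : Fin 3 → ℕ) (φ : R3 → ℝ) : R3 → ℝ :=
  (partialDeriv 0)^[γ 0] ((partialDeriv 1)^[γ 1] ((partialDeriv 2)^[γ 2] φ))

/-- Test functions on `Ω`: smooth functions with compact support contained in `Ω`. -/
def IsTestFunction (Ω : Set R3) (φ : R3 → ℝ) : Prop :=
  ContDiff ℝ (⊤ : ℕ∞) φ ∧ HasCompactSupport φ ∧ tsupport φ ⊆ Ω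

/-- `g` is the weak derivative `D^γ u` on the open set `Ω`. Only the values of `u` and `g` on `Ω`
matter. -/
def IsWeakDeriv (Ω : Set R3) (γ : Fin 3 → ℕ) (u g : R3 → ℝ) : Prop :=
  LocallyIntegrableOn u Ω volume ∧ LocallyIntegrableOn g Ω volume ∧
    ∀ φ : R3 → ℝ, IsTestFunction Ω φ →
      ∫ x in Ω, u x * multiDeriv γ φ x = (-1 : ℝ) ^ multiOrder γ * ∫ x in Ω, g x * φ x

/-- Membership in the Sobolev space `W^{k,p}(Ω)`: `u` is in `L^p(Ω)` and has weak derivatives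
of all orders up to `k` in `L^p(Ω)`. -/
def MemW (k : ℕ) (p : ℝ≥0∞) (Ω : Set R3) (u : R3 → ℝ) : Prop :=
  MemLp u p (volume.restrict Ω) ∧
    ∀ γ : Fin 3 → ℕ, multiOrder γ ≤ k →
      ∃ g : R3 → ℝ, IsWeakDeriv Ω γ u g ∧ MemLp g p (volume.restrict Ω)

/-- Membership in `H^k(Ω) = W^{k,2}(Ω)`. -/
def MemH (k : ℕ) (Ω : Set R3) (u : R3 → ℝ) : Prop := MemW k 2 Ω u

/-- Membership of a tensor field in `H^k(Ω)^{3×3}`. -/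
def TensorMemH (k : ℕ) (Ω : Set R3) (T : TensorField) : Prop :=
  ∀ i j, MemH k Ω (fun x => T x i j)

/-- The closed unit hemisphere (half ball) `{|y| ≤ 1, y₃ ≥ 0}`. -/
def hemisphere : Set R3 := {y | ‖y‖ ≤ 1 ∧ 0 ≤ y 2}

/-- The flat face `{|y| ≤ 1, y₃ = 0}` of the hemisphere. -/
def flatFace : Set R3 := {y | ‖y‖ ≤ 1 ∧ y 2 = 0}

/-- `Ω` has a Lipschitz boundary: `∂Ω` is covered by finitely many open sets `U m` such that
`closure (U m) ∩ closure Ω` is the image of the hemisphere under a homeomorphism that is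
Lipschitz with Lipschitz inverse and takes the flat face onto `closure (U m) ∩ ∂Ω`. -/
def HasLipschitzBoundary (Ω : Set R3) : Prop :=
  ∃ (M : ℕ) (U : Fin M → Set R3), (∀ m, IsOpen (U m)) ∧ frontier Ω ⊆ ⋃ m, U m ∧
    ∃ K : ℝ≥0, ∀ m, ∃ Φ Ψ : R3 → R3,
      LipschitzOnWith K Φ hemisphere ∧
      LipschitzOnWith K Ψ (closure (U m) ∩ closure Ω) ∧
      Set.LeftInvOn Ψ Φ hemisphere ∧
      Φ '' hemisphere = closure (U m) ∩ closure Ω ∧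
      Φ '' flatFace = closure (U m) ∩ frontier Ω

/-- A bounded domain (nonempty, open, connected) in `R3` with Lipschitz boundary. -/
structure IsBoundedLipschitzDomain (Ω : Set R3) : Prop where
  isOpen : IsOpen Ω
  isConnected : IsConnected Ω
  isBounded : Bornology.IsBounded Ω
  lipschitz : HasLipschitzBoundary Ω

/-- The pointwise inverse tensor `B⁻¹`. -/
def tensorInv (B : TensorField) : TensorField := fun x => (B x)⁻¹

/-- The tensor field `𝒜(B) = μ₁ I + μ₂ B + μ₃ B⁻¹`. -/
def calA (μ₁ μ₂ μ₃ : R3 → ℝ) (B : TensorField) : TensorField :=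
  fun x => μ₁ x • (1 : Matrix (Fin 3) (Fin 3) ℝ) + μ₂ x • B x + μ₃ x • (B x)⁻¹

end Visco

end

/-! Where `det B = 1`, the inverse is the adjugate, whose entries are quadratic polynomials in the
entries of `B`. So everything follows once `Hᵐ(Ω)` is an algebra for `m ≥ 2` (`MemH.mul`).

The algebra property is the case `a = b = k = m` of `memH_mul_of_le`: `Hᵃ · Hᵇ ⊆ Hᵏ` if `k ≤ a`, `k
≤ b` and `k + 2 ≤ a + b`. This goes by induction on `k` with the weak product rule; the base case is
Hölder's inequality with the embeddings `H¹ ⊆ L⁴` and `H² ⊆ L^∞`.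

The embeddings need no extension operator. Finitely many bi-Lipschitz images of bounded convex sets
cover `Ω`. On each convex set `C` with chart `Φ`, interior mollification gives, for almost all `x,
y`, `|u(Φ x) - u(Φ y)| ≤ L ∫₀¹ G(x + t(y - x)) dt`, where `G` is the sum of the absolute weak
partial derivatives along `Φ`. Averaging over `y` and substituting `z = x + t(y - x)` costs a factor
`t⁻³`. Hölder's inequality in `t` with weight `t^(5/2)` leaves the integrable `t^(-1/2)`, so `G ∈
L⁴` bounds `u` and `G ∈ L²` puts `u` in `L⁴`. -/

namespace Visco
open scoped Convolution Topology
open ContinuousLinearMap (lsmul)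

/-! ### Multi-indices, classical derivatives and test functions -/

theorem multiDeriv_single (i : Fin 3) (φ : R3 → ℝ) :
    multiDeriv (Pi.single i 1) φ = partialDeriv i φ := by
  fin_cases i <;> simp [multiDeriv]

theorem multiOrder_single (i : Fin 3) : multiOrder (Pi.single i 1) = 1 := by
  simp [multiOrder]

theorem multiOrder_add (γ δ : Fin 3 → ℕ) : multiOrder (γ + δ) = multiOrder γ + multiOrder δ := by
  simp [multiOrder, Finset.sum_add_distrib]

theorem contDiff_partialDeriv {φ : R3 → ℝ} (hφ : ContDiff ℝ (⊤ : ℕ∞) φ) (i : Fin 3) :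
    ContDiff ℝ (⊤ : ℕ∞) (partialDeriv i φ) :=
  (hφ.fderiv_right (m := (⊤ : ℕ∞)) (by simp)).clm_apply contDiff_const

theorem tsupport_partialDeriv_subset (φ : R3 → ℝ) (i : Fin 3) :
    tsupport (partialDeriv i φ) ⊆ tsupport φ :=
  (closure_mono (fun x hx => by
    intro h
    apply hx
    simp [partialDeriv, h])).trans (tsupport_fderiv_subset ℝ (f := φ))

theorem IsTestFunction.partialDeriv {Ω : Set R3} {φ : R3 → ℝ} (hφ : IsTestFunction Ω φ)
    (i : Fin 3) : IsTestFunction Ω (partialDeriv i φ) :=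
  ⟨contDiff_partialDeriv hφ.1 i,
    hφ.2.1.mono' (subset_closure.trans (tsupport_partialDeriv_subset φ i)),
    (tsupport_partialDeriv_subset φ i).trans hφ.2.2⟩

theorem IsTestFunction.iterate {Ω : Set R3} (i : Fin 3) (n : ℕ) {φ : R3 → ℝ}
    (hφ : IsTestFunction Ω φ) : IsTestFunction Ω ((Visco.partialDeriv i)^[n] φ) := by
  induction n with
  | zero => exact hφ
  | succ n ih => rw [Function.iterate_succ_apply']; exact ih.partialDeriv i

theorem IsTestFunction.multiDeriv {Ω : Set R3} {φ : R3 → ℝ} (hφ : IsTestFunction Ω φ)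
    (γ : Fin 3 → ℕ) : IsTestFunction Ω (multiDeriv γ φ) :=
  ((hφ.iterate 2 _).iterate 1 _).iterate 0 _

theorem partialDeriv_comm {φ : R3 → ℝ} (hφ : ContDiff ℝ (⊤ : ℕ∞) φ) (i j : Fin 3) :
    partialDeriv i (partialDeriv j φ) = partialDeriv j (partialDeriv i φ) := by
  have hd : ∀ k : Fin 3, ∀ x, fderiv ℝ (partialDeriv k φ) x =
      (fderiv ℝ (fderiv ℝ φ) x).flip (EuclideanSpace.single k 1) := by
    intro k x
    have h1 : DifferentiableAt ℝ (fderiv ℝ φ) x :=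
      ((hφ.fderiv_right (m := (⊤ : ℕ∞)) (by simp)).differentiable (by simp)) x
    have := (h1.hasFDerivAt.clm_apply (hasFDerivAt_const (EuclideanSpace.single k (1 : ℝ)) x)).fderiv
    simp only [ContinuousLinearMap.comp_zero, zero_add] at this
    exact this
  have hs : ∀ x, IsSymmSndFDerivAt ℝ φ x := fun x =>
    (hφ.contDiffAt (x := x)).isSymmSndFDerivAt
      (by rw [minSmoothness_of_isRCLikeNormedField]; exact WithTop.coe_le_coe.2 le_top)
  funext x
  have h1 := hd j x
  have h2 := hd i x
  simp only [partialDeriv] at h1 h2 ⊢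
  rw [h1, h2]
  exact hs x _ _

theorem contDiff_iterate_partialDeriv {φ : R3 → ℝ} (hφ : ContDiff ℝ (⊤ : ℕ∞) φ) (i : Fin 3)
    (n : ℕ) : ContDiff ℝ (⊤ : ℕ∞) ((partialDeriv i)^[n] φ) := by
  induction n with
  | zero => exact hφ
  | succ n ih => rw [Function.iterate_succ_apply']; exact contDiff_partialDeriv ih i

theorem partialDeriv_iterate_comm {φ : R3 → ℝ} (hφ : ContDiff ℝ (⊤ : ℕ∞) φ) (i j : Fin 3)
    (n : ℕ) : partialDeriv i ((partialDeriv j)^[n] φ) = (partialDeriv j)^[n] (partialDeriv i φ) := by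
  induction n with
  | zero => rfl
  | succ n ih =>
    rw [Function.iterate_succ_apply', Function.iterate_succ_apply',
      partialDeriv_comm (contDiff_iterate_partialDeriv hφ j n), ih]

theorem partialDeriv_multiDeriv {φ : R3 → ℝ} (hφ : ContDiff ℝ (⊤ : ℕ∞) φ) (i : Fin 3)
    (γ : Fin 3 → ℕ) : partialDeriv i (multiDeriv γ φ) = multiDeriv γ (partialDeriv i φ) := by
  have h2 := contDiff_iterate_partialDeriv hφ 2 (γ 2)
  have h1 := contDiff_iterate_partialDeriv h2 1 (γ 1)
  rw [multiDeriv, partialDeriv_iterate_comm h1, partialDeriv_iterate_comm h2,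
    partialDeriv_iterate_comm hφ]
  rfl

/-- `multiDeriv` applies the coordinates in a fixed order, so the extra derivative must be commuted
past the outer ones. -/
theorem multiDeriv_add_single {φ : R3 → ℝ} (hφ : ContDiff ℝ (⊤ : ℕ∞) φ) (i : Fin 3)
    (γ : Fin 3 → ℕ) : multiDeriv (γ + Pi.single i 1) φ = multiDeriv γ (partialDeriv i φ) := by
  have h2 := contDiff_iterate_partialDeriv hφ 2 (γ 2)
  fin_cases i
  · have h1 := contDiff_iterate_partialDeriv h2 1 (γ 1)
    simp [multiDeriv, ← partialDeriv_iterate_comm hφ, ← partialDeriv_iterate_comm h2]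
  · simp [multiDeriv, ← partialDeriv_iterate_comm hφ]
  · simp [multiDeriv]

/-! ### The spaces `Hᵏ`: recursion in `k` and linear structure -/

theorem locallyIntegrableOn_of_memLp {Ω : Set R3} {u : R3 → ℝ}
    (hu : MemLp u 2 (volume.restrict Ω)) : LocallyIntegrableOn u Ω volume :=
  locallyIntegrableOn_of_locallyIntegrable_restrict (hu.locallyIntegrable (by norm_num))

theorem memH_zero_iff {Ω : Set R3} {u : R3 → ℝ} :
    MemH 0 Ω u ↔ MemLp u 2 (volume.restrict Ω) := by
  refine ⟨fun h => h.1, fun h => ⟨h, fun γ hγ => ⟨u, ⟨locallyIntegrableOn_of_memLp h,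
    locallyIntegrableOn_of_memLp h, fun φ _ => ?_⟩, h⟩⟩⟩
  have : γ = 0 := by
    funext i
    have : γ i ≤ multiOrder γ := Finset.single_le_sum (fun _ _ => Nat.zero_le _) (Finset.mem_univ i)
    simp; omega
  subst this
  simp [multiDeriv, multiOrder]

theorem IsWeakDeriv.add_single {Ω : Set R3} {u g h : R3 → ℝ} {i : Fin 3} {γ : Fin 3 → ℕ}
    (hg : IsWeakDeriv Ω (Pi.single i 1) u g) (hh : IsWeakDeriv Ω γ g h) :
    IsWeakDeriv Ω (γ + Pi.single i 1) u h := by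
  refine ⟨hg.1, hh.2.1, fun φ hφ => ?_⟩
  have h1 := hg.2.2 _ (hφ.multiDeriv γ)
  have h2 := hh.2.2 _ hφ
  rw [multiDeriv_single, partialDeriv_multiDeriv hφ.1, ← multiDeriv_add_single hφ.1, h2,
    multiOrder_single] at h1
  rw [h1, multiOrder_add, multiOrder_single]
  ring

theorem IsWeakDeriv.of_add_single {Ω : Set R3} {u g h : R3 → ℝ} {i : Fin 3} {γ : Fin 3 → ℕ}
    (hg : IsWeakDeriv Ω (Pi.single i 1) u g) (hh : IsWeakDeriv Ω (γ + Pi.single i 1) u h) :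
    IsWeakDeriv Ω γ g h := by
  refine ⟨hg.2.1, hh.2.1, fun φ hφ => ?_⟩
  have h1 := hg.2.2 _ (hφ.multiDeriv γ)
  have h2 := hh.2.2 _ hφ
  rw [multiDeriv_single, partialDeriv_multiDeriv hφ.1, ← multiDeriv_add_single hφ.1, h2,
    multiOrder_single, multiOrder_add, multiOrder_single] at h1
  rw [pow_succ] at h1
  linarith

/-- This replaces multi-indices by a recursion on `k`, the form used in every later induction. One
direction strips `∂ᵢ` off a higher weak derivative (`IsWeakDeriv.of_add_single`), the other composes
weak derivatives (`IsWeakDeriv.add_single`). -/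
theorem memH_succ_iff {Ω : Set R3} {u : R3 → ℝ} {k : ℕ} :
    MemH (k + 1) Ω u ↔ MemLp u 2 (volume.restrict Ω) ∧
      ∀ i : Fin 3, ∃ g, IsWeakDeriv Ω (Pi.single i 1) u g ∧ MemH k Ω g := by
  constructor
  · rintro ⟨h0, h⟩
    refine ⟨h0, fun i => ?_⟩
    obtain ⟨g, hg, hg2⟩ := h (Pi.single i 1) (by rw [multiOrder_single]; omega)
    refine ⟨g, hg, hg2, fun γ hγ => ?_⟩
    obtain ⟨f, hf, hf2⟩ := h (γ + Pi.single i 1) (by rw [multiOrder_add, multiOrder_single]; omega)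
    exact ⟨f, hg.of_add_single hf, hf2⟩
  · rintro ⟨h0, h⟩
    refine ⟨h0, fun γ hγ => ?_⟩
    by_cases hz : ∃ i, γ i ≠ 0
    · obtain ⟨i, hi⟩ := hz
      obtain ⟨g, hg, hgk⟩ := h i
      -- The truncated subtraction is harmless because `γ i ≠ 0`.
      have hγ' : γ = (γ - Pi.single i 1) + Pi.single i 1 := by
        funext j
        by_cases hj : j = i
        · subst hj; simp; omega
        · simp [hj]
      rw [hγ', multiOrder_add, multiOrder_single] at hγ
      obtain ⟨f, hf, hf2⟩ := hgk.2 (γ - Pi.single i 1) (by omega)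
      exact ⟨f, hγ' ▸ hg.add_single hf, hf2⟩
    · push Not at hz
      exact (memH_zero_iff.2 h0).2 γ (by simp [multiOrder, hz])

theorem memH_of_le {Ω : Set R3} {u : R3 → ℝ} {k l : ℕ} (hkl : k ≤ l) (hu : MemH l Ω u) :
    MemH k Ω u :=
  ⟨hu.1, fun γ hγ => hu.2 γ (hγ.trans hkl)⟩

theorem IsWeakDeriv.congr_ae {Ω : Set R3} {u u' g g' : R3 → ℝ} {γ : Fin 3 → ℕ}
    (h : IsWeakDeriv Ω γ u g) (hu : u =ᵐ[volume.restrict Ω] u') (hg : g =ᵐ[volume.restrict Ω] g')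
    (hu' : LocallyIntegrableOn u' Ω) (hg' : LocallyIntegrableOn g' Ω) :
    IsWeakDeriv Ω γ u' g' := by
  refine ⟨hu', hg', fun φ hφ => ?_⟩
  have h1 : ∫ x in Ω, u' x * multiDeriv γ φ x = ∫ x in Ω, u x * multiDeriv γ φ x :=
    integral_congr_ae (by filter_upwards [hu] with x hx; rw [hx])
  have h2 : ∫ x in Ω, g' x * φ x = ∫ x in Ω, g x * φ x :=
    integral_congr_ae (by filter_upwards [hg] with x hx; rw [hx])
  rw [h1, h2, h.2.2 φ hφ]

theorem MemH.congr_ae {Ω : Set R3} {u u' : R3 → ℝ} {k : ℕ} (h : MemH k Ω u)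
    (hu : u =ᵐ[volume.restrict Ω] u') : MemH k Ω u' := by
  have hu' := (memLp_congr_ae hu).1 h.1
  refine ⟨hu', fun γ hγ => ?_⟩
  obtain ⟨g, hg, hg2⟩ := h.2 γ hγ
  exact ⟨g, hg.congr_ae hu .rfl (locallyIntegrableOn_of_memLp hu') hg.2.1, hg2⟩

theorem IsTestFunction.integrable_mul {Ω : Set R3} {u φ : R3 → ℝ}
    (hφ : IsTestFunction Ω φ) (hu : MemLp u 2 (volume.restrict Ω)) :
    Integrable (fun x => u x * φ x) (volume.restrict Ω) :=
  hu.integrable_mul (q := 2) ((hφ.1.continuous.memLp_of_hasCompactSupport hφ.2.1).restrict Ω)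

theorem IsWeakDeriv.add {Ω : Set R3} {u u' g g' : R3 → ℝ} {γ : Fin 3 → ℕ}
    (h : IsWeakDeriv Ω γ u g) (h' : IsWeakDeriv Ω γ u' g')
    (hu : MemLp u 2 (volume.restrict Ω)) (hu' : MemLp u' 2 (volume.restrict Ω))
    (hg : MemLp g 2 (volume.restrict Ω)) (hg' : MemLp g' 2 (volume.restrict Ω)) :
    IsWeakDeriv Ω γ (u + u') (g + g') := by
  refine ⟨locallyIntegrableOn_of_memLp (hu.add hu'), locallyIntegrableOn_of_memLp (hg.add hg'),
    fun φ hφ => ?_⟩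
  simp only [Pi.add_apply, add_mul]
  rw [integral_add ((hφ.multiDeriv γ).integrable_mul hu) ((hφ.multiDeriv γ).integrable_mul hu'),
    integral_add (hφ.integrable_mul hg) (hφ.integrable_mul hg'), h.2.2 φ hφ, h'.2.2 φ hφ, mul_add]

theorem MemH.add {Ω : Set R3} {u v : R3 → ℝ} {k : ℕ} (hu : MemH k Ω u) (hv : MemH k Ω v) :
    MemH k Ω (u + v) := by
  refine ⟨hu.1.add hv.1, fun γ hγ => ?_⟩
  obtain ⟨g, hg, hg2⟩ := hu.2 γ hγ
  obtain ⟨h, hh, hh2⟩ := hv.2 γ hγ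
  exact ⟨g + h, hg.add hh hu.1 hv.1 hg2 hh2, hg2.add hh2⟩

theorem MemH.neg {Ω : Set R3} {u : R3 → ℝ} {k : ℕ} (hu : MemH k Ω u) : MemH k Ω (-u) := by
  refine ⟨hu.1.neg, fun γ hγ => ?_⟩
  obtain ⟨g, hg, hg2⟩ := hu.2 γ hγ
  refine ⟨-g, ⟨locallyIntegrableOn_of_memLp hu.1.neg, locallyIntegrableOn_of_memLp hg2.neg,
    fun φ hφ => ?_⟩, hg2.neg⟩
  simp [integral_neg, hg.2.2 φ hφ]

/-! ### Mollification in `L²` -/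

theorem lintegral_enorm_pow_eq {α : Type*} [MeasurableSpace α] {μ : Measure α} (f : α → ℝ)
    {n : ℕ} (hn : n ≠ 0) : ∫⁻ x, ‖f x‖ₑ ^ n ∂μ = eLpNorm f n μ ^ n := by
  have h := eLpNorm_nnreal_pow_eq_lintegral (f := f) (μ := μ) (p := (n : ℝ≥0)) (by simpa using hn)
  simpa using h.symm

/-- Cauchy–Schwarz against the constant 1. The measure is arbitrary so that weights can be absorbed
into it as densities. -/
theorem sq_lintegral_le {α : Type*} [MeasurableSpace α] (ν : Measure α) {f : α → ℝ≥0∞}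
    (hf : AEMeasurable f ν) : (∫⁻ x, f x ∂ν) ^ 2 ≤ ν Set.univ * ∫⁻ x, f x ^ 2 ∂ν := by
  have h := ENNReal.lintegral_mul_le_Lp_mul_Lq ν Real.HolderConjugate.two_two
    (aemeasurable_const (b := (1 : ℝ≥0∞))) hf
  have h2 := pow_le_pow_left₀ zero_le h 2
  rw [mul_pow, ← ENNReal.rpow_natCast, ← ENNReal.rpow_natCast, ← ENNReal.rpow_natCast,
    ← ENNReal.rpow_mul, ← ENNReal.rpow_mul] at h2
  simpa using h2

theorem pow_four_lintegral_le {α : Type*} [MeasurableSpace α] (ν : Measure α) {f : α → ℝ≥0∞}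
    (hf : AEMeasurable f ν) : (∫⁻ x, f x ∂ν) ^ 4 ≤ ν Set.univ ^ 3 * ∫⁻ x, f x ^ 4 ∂ν := by
  have h2 := sq_lintegral_le ν (hf.pow_const 2)
  calc (∫⁻ x, f x ∂ν) ^ 4 = ((∫⁻ x, f x ∂ν) ^ 2) ^ 2 := by ring
    _ ≤ (ν Set.univ * ∫⁻ x, f x ^ 2 ∂ν) ^ 2 := by gcongr; exact sq_lintegral_le ν hf
    _ = ν Set.univ ^ 2 * (∫⁻ x, f x ^ 2 ∂ν) ^ 2 := by ring
    _ ≤ ν Set.univ ^ 2 * (ν Set.univ * ∫⁻ x, (f x ^ 2) ^ 2 ∂ν) := by gcongr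
    _ = ν Set.univ ^ 3 * ∫⁻ x, f x ^ 4 ∂ν := by simp_rw [← pow_mul]; ring

/-- Translations act continuously on `L²`; this is the continuity at `y = 0`. -/
theorem exists_lintegral_translate_sub_le {h : R3 → ℝ} (hh : MemLp h 2 volume) {ε : ℝ≥0∞}
    (hε : ε ≠ 0) : ∃ δ > 0, ∀ y : R3, ‖y‖ < δ → ∫⁻ x, ‖h (x - y) - h x‖ₑ ^ 2 ≤ ε := by
  have : Fact ((2 : ℝ≥0∞) ≠ ∞) := ⟨by norm_num⟩
  have hc : Continuous fun y : R3 => DomAddAct.mk y +ᵥ hh.toLp h := by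
    have h1 : Continuous (DomAddAct.mk : R3 → R3ᵈᵃᵃ) := DomAddAct.continuous_mk
    exact h1.vadd continuous_const
  have ht := hc.tendsto 0
  have h0 : DomAddAct.mk (0 : R3) +ᵥ hh.toLp h = hh.toLp h := zero_vadd R3ᵈᵃᵃ _
  rw [h0, EMetric.tendsto_nhds] at ht
  have hε' : 0 < ε ^ (2⁻¹ : ℝ) := by
    rw [pos_iff_ne_zero]
    simp [hε]
  obtain ⟨δ, hδ, H⟩ := Metric.eventually_nhds_iff.1 (ht _ hε')
  refine ⟨δ, hδ, fun y hy => ?_⟩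
  have h1 := (H (y := -y) (by simpa using hy)).le
  rw [DomAddAct.mk_vadd_toLp, Lp.edist_toLp_toLp] at h1
  have h2 := lintegral_enorm_pow_eq (μ := (volume : Measure R3)) (fun x => h (x - y) - h x)
    (n := 2) (by norm_num)
  rw [h2]
  have h3 : eLpNorm (fun x => h (x - y) - h x) 2 volume ≤ ε ^ (2⁻¹ : ℝ) := by
    have he : (fun x => h (x - y) - h x) = (fun x => h (-y +ᵥ x)) - h := by
      funext x
      simp [neg_add_eq_sub]
    rwa [he]
  calc _ ≤ (ε ^ (2⁻¹ : ℝ)) ^ 2 := by gcongr; exact_mod_cast h3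
    _ = ε := by rw [← ENNReal.rpow_natCast, ← ENNReal.rpow_mul]; simp

/-- The mollification of `h` by the normalized bump function `φ`. -/
noncomputable def mollify (φ : ContDiffBump (0 : R3)) (h : R3 → ℝ) : R3 → ℝ :=
  φ.normed volume ⋆[lsmul ℝ ℝ, volume] h

theorem mollify_sub_eq (φ : ContDiffBump (0 : R3)) {h : R3 → ℝ} (hh : LocallyIntegrable h volume)
    (x : R3) : mollify φ h x - h x = ∫ t, φ.normed volume t * (h (x - t) - h x) := by
  have h1 : Integrable (fun t => φ.normed volume t * h (x - t)) :=
    (φ.hasCompactSupport_normed.convolutionExists_left (lsmul ℝ ℝ) φ.continuous_normed hh) x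
  simp only [mul_sub]
  rw [integral_sub h1 (φ.integrable_normed.mul_const _), integral_mul_const, φ.integral_normed,
    one_mul]
  rfl

theorem lintegral_enorm_normed (φ : ContDiffBump (0 : R3)) :
    ∫⁻ t, ‖φ.normed volume t‖ₑ = 1 := by
  rw [← ofReal_integral_norm_eq_lintegral_enorm φ.integrable_normed]
  simp [abs_of_nonneg (φ.nonneg_normed _), φ.integral_normed]

/-- The mollification error at `x` is an average of `h (x - t) - h x` against a probability density.
Jensen's inequality moves the square inside, and Tonelli reduces the bound to translations shorter
than `δ`. -/
theorem lintegral_mollify_sub_le_of_measurable {h : R3 → ℝ} (hm : Measurable h)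
    (hh : MemLp h 2 volume) {ε : ℝ≥0∞} {δ : ℝ}
    (hδ : ∀ y : R3, ‖y‖ < δ → ∫⁻ x, ‖h (x - y) - h x‖ₑ ^ 2 ≤ ε) (φ : ContDiffBump (0 : R3))
    (hφ : φ.rOut < δ) : ∫⁻ x, ‖mollify φ h x - h x‖ₑ ^ 2 ≤ ε := by
  have hφm : Measurable fun t => ‖φ.normed volume t‖ₑ := φ.continuous_normed.measurable.enorm
  have key : ∀ x, ‖mollify φ h x - h x‖ₑ ^ 2 ≤
      ∫⁻ t, ‖φ.normed volume t‖ₑ * ‖h (x - t) - h x‖ₑ ^ 2 := by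
    intro x
    have hfm : Measurable fun t => ‖h (x - t) - h x‖ₑ := by fun_prop
    rw [mollify_sub_eq φ (hh.locallyIntegrable (by norm_num))]
    -- The kernel becomes the density of a measure of total mass 1, so Cauchy–Schwarz has constant
    -- 1.
    have h1 := sq_lintegral_le (volume.withDensity fun t => ‖φ.normed volume t‖ₑ)
      hfm.aemeasurable
    rw [lintegral_withDensity_eq_lintegral_mul _ hφm hfm,
      lintegral_withDensity_eq_lintegral_mul _ hφm (hfm.pow_const 2), withDensity_apply _ .univ,
      setLIntegral_univ, lintegral_enorm_normed, one_mul] at h1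
    refine le_trans ?_ h1
    gcongr
    refine (enorm_integral_le_lintegral_enorm _).trans (le_of_eq ?_)
    simp [enorm_mul]
  calc ∫⁻ x, ‖mollify φ h x - h x‖ₑ ^ 2
      ≤ ∫⁻ x, ∫⁻ t, ‖φ.normed volume t‖ₑ * ‖h (x - t) - h x‖ₑ ^ 2 := lintegral_mono key
    _ = ∫⁻ t, ∫⁻ x, ‖φ.normed volume t‖ₑ * ‖h (x - t) - h x‖ₑ ^ 2 := by
      refine lintegral_lintegral_swap (Measurable.aemeasurable ?_)
      have : Measurable fun p : R3 × R3 => ‖φ.normed volume p.2‖ₑ := hφm.comp measurable_snd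
      simp only [Function.uncurry_def]
      refine this.mul ?_
      fun_prop
    _ ≤ ∫⁻ t, ‖φ.normed volume t‖ₑ * ε := by
      refine lintegral_mono fun t => ?_
      rw [lintegral_const_mul _ (by fun_prop)]
      by_cases ht : ‖t‖ < δ
      · gcongr
        exact hδ t ht
      · have : φ.normed volume t = 0 := by
          by_contra h0
          have : t ∈ Function.support (φ.normed volume) := h0
          rw [φ.support_normed_eq, mem_ball_zero_iff] at this
          exact ht (this.trans hφ)
        simp [this]
    _ = ε := by rw [lintegral_mul_const _ hφm, lintegral_enorm_normed, one_mul]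

theorem exists_lintegral_mollify_sub_le {h : R3 → ℝ} (hh : MemLp h 2 volume) {ε : ℝ≥0∞}
    (hε : ε ≠ 0) : ∃ δ > 0, ∀ φ : ContDiffBump (0 : R3), φ.rOut < δ →
      ∫⁻ x, ‖mollify φ h x - h x‖ₑ ^ 2 ≤ ε := by
  have hm := hh.aestronglyMeasurable
  have hh' := (memLp_congr_ae hm.ae_eq_mk).1 hh
  obtain ⟨δ, hδ, H⟩ := exists_lintegral_translate_sub_le hh' hε
  refine ⟨δ, hδ, fun φ hφ => ?_⟩
  refine le_of_eq_of_le (lintegral_congr_ae ?_) (lintegral_mollify_sub_le_of_measurable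
    hm.stronglyMeasurable_mk.measurable hh' H φ hφ)
  have hc : mollify φ h = mollify φ (hm.mk h) :=
    convolution_congr (lsmul ℝ ℝ) Filter.EventuallyEq.rfl hm.ae_eq_mk
  filter_upwards [hm.ae_eq_mk] with x hx
  rw [hc, hx]

theorem contDiff_mollify (φ : ContDiffBump (0 : R3)) {h : R3 → ℝ}
    (hh : LocallyIntegrable h volume) : ContDiff ℝ (⊤ : ℕ∞) (mollify φ h) :=
  φ.hasCompactSupport_normed.contDiff_convolution_left _ φ.contDiff_normed hh

theorem partialDeriv_convolution {ρ h : R3 → ℝ} (hρ : HasCompactSupport ρ) (hρ1 : ContDiff ℝ 1 ρ)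
    (hh : LocallyIntegrable h volume) (i : Fin 3) (x : R3) :
    partialDeriv i (ρ ⋆[lsmul ℝ ℝ, volume] h) x = ∫ y, h y * partialDeriv i ρ (x - y) := by
  have hd := hρ.hasFDerivAt_convolution_left (lsmul ℝ ℝ) hρ1 hh x
  have hi : Integrable (fun t => (lsmul ℝ ℝ).precompL R3 (fderiv ℝ ρ t) (h (x - t))) :=
    (hρ.fderiv ℝ).convolutionExists_left _ (hρ1.continuous_fderiv (by simp)) hh x
  rw [partialDeriv, hd.fderiv, convolution_def, ContinuousLinearMap.integral_apply hi,
    ← integral_sub_left_eq_self _ volume x]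
  refine integral_congr_ae (.of_forall fun y => ?_)
  simp only [ContinuousLinearMap.precompL_apply, sub_sub_cancel, ContinuousLinearMap.lsmul_apply, smul_eq_mul,
    partialDeriv]
  exact mul_comm _ _

theorem partialDeriv_mollify (φ : ContDiffBump (0 : R3)) {h : R3 → ℝ}
    (hh : LocallyIntegrable h volume) (i : Fin 3) (x : R3) :
    partialDeriv i (mollify φ h) x = ∫ y, h y * partialDeriv i (φ.normed volume) (x - y) :=
  partialDeriv_convolution φ.hasCompactSupport_normed φ.contDiff_normed hh i x

/-- When the ball around `x` lies in `Ω`, the kernel `y ↦ φ(x - y)` is itself a test function on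
`Ω`. The minus sign from the reflection cancels the one in the weak derivative. -/
theorem partialDeriv_mollify_indicator {Ω : Set R3} (hΩ : IsOpen Ω) {u g : R3 → ℝ} {i : Fin 3}
    (hu : MemLp u 2 (volume.restrict Ω)) (hg : IsWeakDeriv Ω (Pi.single i 1) u g)
    (φ : ContDiffBump (0 : R3)) {x : R3} (hx : Metric.closedBall x φ.rOut ⊆ Ω) :
    partialDeriv i (mollify φ (Ω.indicator u)) x = mollify φ (Ω.indicator g) x := by
  have hu' : MemLp (Ω.indicator u) 2 volume := (memLp_indicator_iff_restrict hΩ.measurableSet).2 hu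
  have hsm : ContDiff ℝ (⊤ : ℕ∞) fun y => φ.normed volume (x - y) :=
    φ.contDiff_normed.comp (contDiff_const.sub contDiff_id)
  have hts : tsupport (fun y => φ.normed volume (x - y)) ⊆ Metric.closedBall x φ.rOut := by
    refine closure_minimal (fun y hy => ?_) Metric.isClosed_closedBall
    have : x - y ∈ Function.support (φ.normed volume) := hy
    rw [φ.support_normed_eq, mem_ball_zero_iff] at this
    rw [Metric.mem_closedBall, dist_comm, dist_eq_norm]
    exact this.le
  have htest : IsTestFunction Ω fun y => φ.normed volume (x - y) :=
    ⟨hsm, HasCompactSupport.of_support_subset_isCompact (isCompact_closedBall x φ.rOut)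
      (subset_closure.trans hts), hts.trans hx⟩
  have hpd : ∀ y, partialDeriv i (fun y => φ.normed volume (x - y)) y =
      - partialDeriv i (φ.normed volume) (x - y) := by
    intro y
    have h1 : HasFDerivAt (φ.normed volume) (fderiv ℝ (φ.normed volume) (x - y)) (x - y) :=
      ((φ.contDiff_normed (n := 1)).differentiable (by simp) _).hasFDerivAt
    have h2 := h1.comp y ((hasFDerivAt_id y).const_sub x)
    have h3 := h2.fderiv
    simp only [partialDeriv]
    change fderiv ℝ (φ.normed volume ∘ fun y => x - y) y _ = _
    rw [h3]
    simp
  have h := hg.2.2 _ htest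
  rw [multiDeriv_single, multiOrder_single] at h
  rw [partialDeriv_mollify φ (hu'.locallyIntegrable (by norm_num))]
  rw [mollify, convolution_lsmul_swap]
  simp only [smul_eq_mul, hpd, mul_neg, integral_neg, pow_one, neg_mul, one_mul, neg_inj] at h ⊢
  have e1 : ∀ y, Ω.indicator u y * partialDeriv i (φ.normed volume) (x - y) =
      Ω.indicator (fun y => u y * partialDeriv i (φ.normed volume) (x - y)) y := by
    intro y; by_cases hy : y ∈ Ω <;> simp [hy]
  have e2 : ∀ y, φ.normed volume (x - y) * Ω.indicator g y =
      Ω.indicator (fun y => g y * φ.normed volume (x - y)) y := by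
    intro y; by_cases hy : y ∈ Ω <;> simp [hy, mul_comm]
  simp only [e1, e2]
  rw [integral_indicator hΩ.measurableSet, integral_indicator hΩ.measurableSet, h]

/-- Local approximation by smooth functions in `H¹`. -/
theorem exists_contDiff_approx {Ω : Set R3} (hΩ : IsOpen Ω) {K : Set R3} (hK : IsCompact K)
    (hKΩ : K ⊆ Ω) {u : R3 → ℝ} {g : Fin 3 → R3 → ℝ} (hu : MemLp u 2 (volume.restrict Ω))
    (hg : ∀ i, MemLp (g i) 2 (volume.restrict Ω))
    (hug : ∀ i, IsWeakDeriv Ω (Pi.single i 1) u (g i)) {ε : ℝ≥0∞} (hε : ε ≠ 0) :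
    ∃ w : R3 → ℝ, ContDiff ℝ (⊤ : ℕ∞) w ∧ ∫⁻ x in K, ‖w x - u x‖ₑ ^ 2 ≤ ε ∧
      ∀ i, ∫⁻ x in K, ‖partialDeriv i w x - g i x‖ₑ ^ 2 ≤ ε := by
  have hu' : MemLp (Ω.indicator u) 2 volume := (memLp_indicator_iff_restrict hΩ.measurableSet).2 hu
  have hg' : ∀ i, MemLp (Ω.indicator (g i)) 2 volume := fun i =>
    (memLp_indicator_iff_restrict hΩ.measurableSet).2 (hg i)
  obtain ⟨δ, hδ, hδΩ⟩ := hK.exists_cthickening_subset_open hΩ hKΩ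
  obtain ⟨δ₀, hδ₀, H₀⟩ := exists_lintegral_mollify_sub_le hu' hε
  choose δ₁ hδ₁ H₁ using fun i => exists_lintegral_mollify_sub_le (hg' i) hε
  obtain ⟨r, hr, hrδ, hrδ₀, hrδ₁⟩ : ∃ r > 0, r < δ ∧ r < δ₀ ∧ ∀ i, r < δ₁ i := by
    have : ∀ᶠ r in 𝓝[>] (0 : ℝ), r < δ ∧ r < δ₀ ∧ ∀ i, r < δ₁ i := by
      refine .and ?_ (.and ?_ (Filter.eventually_all.2 fun i => ?_))
      · exact nhdsWithin_le_nhds (eventually_lt_nhds hδ)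
      · exact nhdsWithin_le_nhds (eventually_lt_nhds hδ₀)
      · exact nhdsWithin_le_nhds (eventually_lt_nhds (hδ₁ i))
    obtain ⟨r, hr, h⟩ := (this.and self_mem_nhdsWithin).exists
    exact ⟨r, h, hr⟩
  -- One radius below all thresholds: the ball around each point of `K` stays in `Ω`, and `u` and
  -- all `g i` are approximated at once.
  let φ : ContDiffBump (0 : R3) := ⟨r / 2, r, by positivity, by linarith⟩
  refine ⟨mollify φ (Ω.indicator u), contDiff_mollify φ (hu'.locallyIntegrable (by norm_num)),
    ?_, fun i => ?_⟩
  · refine le_trans ?_ (H₀ φ hrδ₀)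
    refine le_trans (le_of_eq ?_) (setLIntegral_le_lintegral K _)
    exact setLIntegral_congr_fun hK.measurableSet fun x hx => by simp [hKΩ hx]
  · refine le_trans ?_ (H₁ i φ (hrδ₁ i))
    refine le_trans (le_of_eq ?_) (setLIntegral_le_lintegral K _)
    refine setLIntegral_congr_fun hK.measurableSet fun x hx => ?_
    have hb : Metric.closedBall x φ.rOut ⊆ Ω :=
      (Metric.closedBall_subset_cthickening hx _).trans
        ((Metric.cthickening_mono hrδ.le K).trans hδΩ)
    simp only [partialDeriv_mollify_indicator hΩ hu (hug i) φ hb]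
    simp [hKΩ hx]

/-! ### Increments of smooth functions along Lipschitz curves -/

theorem norm_fderiv_le_sum (w : R3 → ℝ) (x : R3) :
    ‖fderiv ℝ w x‖ ≤ ∑ i, ‖partialDeriv i w x‖ := by
  refine ContinuousLinearMap.opNorm_le_bound _ (Finset.sum_nonneg fun _ _ => norm_nonneg _)
    fun v => ?_
  have hv : v = ∑ i, v i • EuclideanSpace.single i (1 : ℝ) := by
    ext j
    simp [Finset.sum_apply, Pi.single_apply]
  conv_lhs => rw [hv, map_sum]
  rw [Finset.sum_mul]
  refine (norm_sum_le _ _).trans (Finset.sum_le_sum fun i _ => ?_)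
  rw [map_smul, norm_smul, mul_comm]
  exact mul_le_mul_of_nonneg_left (PiLp.norm_apply_le v i) (norm_nonneg _)

/-- The curve is only Lipschitz, so the chain rule is replaced by a bound on right difference
quotients and a comparison principle. -/
theorem norm_comp_sub_le_integral {w : R3 → ℝ} (hw : ContDiff ℝ 1 w) {γ : ℝ → R3} {L : ℝ≥0}
    (hγ : LipschitzWith L γ) :
    ‖w (γ 1) - w (γ 0)‖ ≤ ∫ t in (0 : ℝ)..1, L * ‖fderiv ℝ w (γ t)‖ := by
  have hD : Continuous fun t => (L : ℝ) * ‖fderiv ℝ w (γ t)‖ :=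
    continuous_const.mul ((hw.continuous_fderiv (by simp)).comp hγ.continuous).norm
  -- The slack `ε` supplies the strict derivative inequality that the comparison principle requires.
  refine le_of_forall_pos_le_add fun ε hε => ?_
  have hD' : Continuous fun t => (L : ℝ) * ‖fderiv ℝ w (γ t)‖ + ε := hD.add continuous_const
  have hB : ∀ x, HasDerivAt (fun x => ∫ t in (0 : ℝ)..x, ((L : ℝ) * ‖fderiv ℝ w (γ t)‖ + ε))
      ((L : ℝ) * ‖fderiv ℝ w (γ x)‖ + ε) x := fun x =>
    intervalIntegral.integral_hasDerivAt_right (hD'.intervalIntegrable _ _)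
      hD'.aestronglyMeasurable.stronglyMeasurableAtFilter hD'.continuousAt
  have key := image_norm_le_of_liminf_right_slope_norm_lt_deriv_boundary (a := 0) (b := 1)
    (f := fun t => w (γ t) - w (γ 0)) (f' := fun t => (L : ℝ) * ‖fderiv ℝ w (γ t)‖)
    ((hw.continuous.comp hγ.continuous).sub continuous_const).continuousOn ?_
    (B := fun x => ∫ t in (0 : ℝ)..x, ((L : ℝ) * ‖fderiv ℝ w (γ t)‖ + ε))
    (B' := fun t => (L : ℝ) * ‖fderiv ℝ w (γ t)‖ + ε) (by simp)
    (fun x _ => (hB x).continuousAt.continuousWithinAt)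
    (fun x _ => (hB x).hasDerivWithinAt) (fun x _ _ => by linarith)
    (x := 1) (by simp)
  · refine key.trans (le_of_eq ?_)
    rw [intervalIntegral.integral_add (hD.intervalIntegrable _ _)
      (continuous_const.intervalIntegrable _ _)]
    simp
  · intro x _ r hr
    obtain ⟨c, hc, hcr⟩ : ∃ c : ℝ, ‖fderiv ℝ w (γ x)‖ < c ∧ L * c < r := by
      have h1 : Filter.Tendsto (fun c : ℝ => L * c) (𝓝[>] ‖fderiv ℝ w (γ x)‖)
          (𝓝 (L * ‖fderiv ℝ w (γ x)‖)) :=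
        (continuous_const.mul continuous_id).continuousAt.tendsto.mono_left nhdsWithin_le_nhds
      obtain ⟨c, hc1, hc2⟩ := ((h1.eventually (eventually_lt_nhds hr)).and
        self_mem_nhdsWithin).exists
      exact ⟨c, hc2, hc1⟩
    -- Near `γ x`, `w` is Lipschitz with any constant `c` above the norm of its derivative there.
    have hstrict : HasStrictFDerivAt w (fderiv ℝ w (γ x)) (γ x) :=
      hw.contDiffAt.hasStrictFDerivAt (by simp)
    obtain ⟨s, hs, hlip⟩ := hstrict.exists_lipschitzOnWith_of_nnnorm_lt
      ⟨c, (norm_nonneg _).trans hc.le⟩ (by exact_mod_cast hc)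
    have hev : ∀ᶠ z in 𝓝[>] x, γ z ∈ s :=
      nhdsWithin_le_nhds (hγ.continuous.continuousAt.eventually_mem hs)
    refine (hev.and self_mem_nhdsWithin).frequently.mono fun z ⟨hz, hxz⟩ => ?_
    have hxz' : 0 < z - x := sub_pos.2 hxz
    rw [slope_def_field, div_lt_iff₀ hxz']
    have h1 : ‖w (γ z) - w (γ x)‖ ≤ c * ‖γ z - γ x‖ :=
      hlip.norm_sub_le hz (mem_of_mem_nhds hs)
    have h2 : ‖γ z - γ x‖ ≤ L * (z - x) := by
      have := hγ.norm_sub_le z x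
      rwa [Real.norm_of_nonneg hxz'.le] at this
    have h3 := norm_sub_norm_le (w (γ z) - w (γ 0)) (w (γ x) - w (γ 0))
    rw [sub_sub_sub_cancel_right] at h3
    have hc0 : 0 ≤ c := (norm_nonneg _).trans hc.le
    calc ‖w (γ z) - w (γ 0)‖ - ‖w (γ x) - w (γ 0)‖ ≤ c * (L * (z - x)) :=
          h3.trans (h1.trans (by gcongr))
      _ = L * c * (z - x) := by ring
      _ < r * (z - x) := by gcongr

theorem enorm_comp_sub_le_lintegral {w : R3 → ℝ} (hw : ContDiff ℝ 1 w) {γ : ℝ → R3} {L : ℝ≥0}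
    (hγ : LipschitzWith L γ) :
    ‖w (γ 1) - w (γ 0)‖ₑ ≤ L * ∫⁻ t in Set.Ioo (0 : ℝ) 1, ∑ i, ‖partialDeriv i w (γ t)‖ₑ := by
  have h := norm_comp_sub_le_integral hw hγ
  rw [intervalIntegral.integral_const_mul, intervalIntegral.integral_of_le zero_le_one,
    integral_Ioc_eq_integral_Ioo] at h
  have h1 : ‖w (γ 1) - w (γ 0)‖ₑ ≤ ENNReal.ofReal (L * ∫ t in Set.Ioo (0 : ℝ) 1,
      ‖fderiv ℝ w (γ t)‖) := by
    rw [← ofReal_norm]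
    exact ENNReal.ofReal_le_ofReal h
  refine h1.trans ?_
  have hi : IntegrableOn (fun t => fderiv ℝ w (γ t)) (Set.Ioo (0 : ℝ) 1) :=
    (((hw.continuous_fderiv (by simp)).comp hγ.continuous).integrableOn_Icc).mono_set
      Set.Ioo_subset_Icc_self
  rw [ENNReal.ofReal_mul L.coe_nonneg, ofReal_integral_norm_eq_lintegral_enorm hi,
    ENNReal.ofReal_coe_nnreal]
  gcongr with t
  rw [← ofReal_norm]
  refine (ENNReal.ofReal_le_ofReal (norm_fderiv_le_sum w (γ t))).trans (le_of_eq ?_)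
  rw [ENNReal.ofReal_sum_of_nonneg fun _ _ => norm_nonneg _]
  simp only [ofReal_norm]

/-! ### Segment integrals over convex sets -/

/-- The integral of `G` over the segment from `x` to `y`, in the parameter of the segment. -/
noncomputable def segInt (G : R3 → ℝ≥0∞) (x y : R3) : ℝ≥0∞ :=
  ∫⁻ t in Set.Ioo (0 : ℝ) 1, G (x + t • (y - x))

theorem lintegral_comp_affine (G : R3 → ℝ≥0∞) (a : R3) {r : ℝ} (hr : 0 < r) :
    ∫⁻ x, G (a + r • x) = ENNReal.ofReal (r⁻¹ ^ 3) * ∫⁻ x, G x := by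
  have h1 := (Homeomorph.smulOfNeZero r hr.ne').measurableEmbedding.lintegral_map
    (μ := (volume : Measure R3)) (fun x => G (a + x))
  have h2 : Measure.map (Homeomorph.smulOfNeZero r hr.ne') (volume : Measure R3) =
      ENNReal.ofReal |(r ^ 3)⁻¹| • volume := by
    have := Measure.map_addHaar_smul (volume : Measure R3) hr.ne'
    rwa [finrank_euclideanSpace_fin] at this
  rw [h2, lintegral_smul_measure, lintegral_add_left_eq_self, abs_of_pos (by positivity),
    ← inv_pow] at h1
  exact h1.symm

/-- The substitution `z = x + t(y - x)` has Jacobian `t³`, and convexity keeps `z` in `C`. -/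
theorem setLIntegral_segment_le {C : Set R3} (hC : MeasurableSet C) (hconv : Convex ℝ C)
    (G : R3 → ℝ≥0∞) {x : R3} (hx : x ∈ C) {t : ℝ} (ht : t ∈ Set.Ioo (0 : ℝ) 1) :
    ∫⁻ y in C, G (x + t • (y - x)) ≤ ENNReal.ofReal (t⁻¹ ^ 3) * ∫⁻ z in C, G z := by
  have h1 : ∀ y ∈ C, G (x + t • (y - x)) = C.indicator G ((x - t • x) + t • y) := by
    intro y hy
    have he : x - t • x + t • y = x + t • (y - x) := by rw [smul_sub]; abel
    rw [he, Set.indicator_of_mem]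
    exact hconv.add_smul_sub_mem hx hy ⟨ht.1.le, ht.2.le⟩
  rw [setLIntegral_congr_fun hC h1]
  refine (setLIntegral_le_lintegral _ _).trans ?_
  rw [lintegral_comp_affine _ _ ht.1, lintegral_indicator hC]

/-- The point of the bound is its uniformity in `t`. For `t ≥ 1/2` the factor `t⁻³` is at most 8;
for `t ≤ 1/2` exchanging `x` and `y` turns `t` into `1 - t`. -/
theorem lintegral_lintegral_segment_le {C : Set R3} (hC : MeasurableSet C) (hconv : Convex ℝ C)
    {G : R3 → ℝ≥0∞} (hG : Measurable G) {t : ℝ} (ht : t ∈ Set.Ioo (0 : ℝ) 1) :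
    ∫⁻ x in C, ∫⁻ y in C, G (x + t • (y - x)) ≤ 8 * volume C * ∫⁻ z in C, G z := by
  have h8 : ∀ s : ℝ, 1 / 2 ≤ s → ENNReal.ofReal (s⁻¹ ^ 3) ≤ 8 := by
    intro s hs
    have : s⁻¹ ≤ 2 := by rw [inv_le_comm₀ (by linarith) (by norm_num)]; linarith
    have h0 : 0 ≤ s⁻¹ := by rw [inv_nonneg]; linarith
    refine (ENNReal.ofReal_le_ofReal (pow_le_pow_left₀ h0 this 3)).trans ?_
    norm_num
  have main : ∀ s ∈ Set.Ioo (0 : ℝ) 1, 1 / 2 ≤ s →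
      ∫⁻ x in C, ∫⁻ y in C, G (x + s • (y - x)) ≤ 8 * volume C * ∫⁻ z in C, G z := by
    intro s hs hs2
    calc ∫⁻ x in C, ∫⁻ y in C, G (x + s • (y - x)) ≤ ∫⁻ x in C, 8 * ∫⁻ z in C, G z := by
          refine setLIntegral_mono' hC fun x hx => ?_
          exact (setLIntegral_segment_le hC hconv G hx hs).trans (by gcongr; exact h8 s hs2)
      _ = 8 * volume C * ∫⁻ z in C, G z := by rw [setLIntegral_const]; ring
  rcases le_total (1 / 2) t with h | h
  · exact main t ht h
  · have hsw : ∫⁻ x in C, ∫⁻ y in C, G (x + t • (y - x)) =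
        ∫⁻ y in C, ∫⁻ x in C, G (y + (1 - t) • (x - y)) := by
      rw [lintegral_lintegral_swap (Measurable.aemeasurable (by fun_prop))]
      refine lintegral_congr fun y => lintegral_congr fun x => congrArg G ?_
      module
    rw [hsw]
    exact main (1 - t) ⟨by linarith [ht.2], by linarith [ht.1]⟩ (by linarith)

theorem lintegral_lintegral_segInt_le {C : Set R3} (hC : MeasurableSet C) (hconv : Convex ℝ C)
    {G : R3 → ℝ≥0∞} (hG : Measurable G) :
    ∫⁻ x in C, ∫⁻ y in C, segInt G x y ≤ 8 * volume C * ∫⁻ z in C, G z := by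
  have h1 : ∀ x, ∫⁻ y in C, segInt G x y =
      ∫⁻ t in Set.Ioo (0 : ℝ) 1, ∫⁻ y in C, G (x + t • (y - x)) := fun x =>
    lintegral_lintegral_swap (Measurable.aemeasurable (by fun_prop))
  simp only [h1]
  have hm : Measurable fun p : (R3 × ℝ) × R3 => G (p.1.1 + p.1.2 • (p.2 - p.1.1)) := by fun_prop
  rw [lintegral_lintegral_swap (Measurable.aemeasurable
    (by exact hm.lintegral_prod_right' (ν := volume.restrict C)))]
  calc _ ≤ ∫⁻ t in Set.Ioo (0 : ℝ) 1, 8 * volume C * ∫⁻ z in C, G z :=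
        setLIntegral_mono' measurableSet_Ioo fun t ht =>
          lintegral_lintegral_segment_le hC hconv hG ht
    _ = _ := by simp

theorem measurable_segInt {G : R3 → ℝ≥0∞} (hG : Measurable G) :
    Measurable fun p : R3 × R3 => segInt G p.1 p.2 := by
  have hm : Measurable fun p : (R3 × R3) × ℝ => G (p.1.1 + p.2 • (p.1.2 - p.1.1)) := by fun_prop
  exact hm.lintegral_prod_right' (ν := volume.restrict (Set.Ioo (0 : ℝ) 1))

/-! ### The segment inequality for Sobolev functions -/

theorem lintegral_le_of_lintegral_sq_le {K : Set R3} {f : R3 → ℝ≥0∞}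
    (hf : AEMeasurable f (volume.restrict K)) {ε : ℝ≥0∞}
    (h : ∫⁻ x in K, f x ^ 2 ≤ ε ^ 2 / (volume K + 1)) : ∫⁻ x in K, f x ≤ ε := by
  have h1 := sq_lintegral_le (volume.restrict K) hf
  rw [Measure.restrict_apply_univ] at h1
  refine (ENNReal.pow_le_pow_left_iff (n := 2) (by norm_num)).1 (h1.trans ?_)
  calc volume K * ∫⁻ x in K, f x ^ 2 ≤ (volume K + 1) * (ε ^ 2 / (volume K + 1)) := by
        gcongr
        exact le_self_add
    _ ≤ ε ^ 2 := ENNReal.mul_div_le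

theorem exists_contDiff_approx_L1 {Ω : Set R3} (hΩ : IsOpen Ω) {K : Set R3} (hK : IsCompact K)
    (hKΩ : K ⊆ Ω) {u : R3 → ℝ} {g : Fin 3 → R3 → ℝ} (hum : Measurable u)
    (hgm : ∀ i, Measurable (g i)) (hu : MemLp u 2 (volume.restrict Ω))
    (hg : ∀ i, MemLp (g i) 2 (volume.restrict Ω))
    (hug : ∀ i, IsWeakDeriv Ω (Pi.single i 1) u (g i)) {ε : ℝ≥0∞} (hε : ε ≠ 0) :
    ∃ w : R3 → ℝ, ContDiff ℝ (⊤ : ℕ∞) w ∧ ∫⁻ x in K, ‖w x - u x‖ₑ ≤ ε ∧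
      ∀ i, ∫⁻ x in K, ‖partialDeriv i w x - g i x‖ₑ ≤ ε := by
  have hε' : ε ^ 2 / (volume K + 1) ≠ 0 :=
    (ENNReal.div_pos (pow_ne_zero 2 hε) (by simp [hK.measure_ne_top])).ne'
  obtain ⟨w, hw, h1, h2⟩ := exists_contDiff_approx hΩ hK hKΩ hu hg hug hε'
  exact ⟨w, hw, lintegral_le_of_lintegral_sq_le
    (hw.continuous.measurable.sub hum).enorm.aemeasurable h1, fun i =>
    lintegral_le_of_lintegral_sq_le
    ((contDiff_partialDeriv hw i).continuous.measurable.sub (hgm i)).enorm.aemeasurable (h2 i)⟩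

theorem eq_zero_of_forall_le_mul {A I : ℝ≥0∞} (hA : A ≠ ∞) (h : ∀ ε : ℝ≥0∞, ε ≠ 0 → I ≤ A * ε) :
    I = 0 := by
  by_contra hne
  have h1 : I ≤ A := by simpa using h 1 one_ne_zero
  have hA0 : A ≠ 0 := fun h0 => hne (by simpa [h0] using h1)
  -- This choice of `ε` gives `I ≤ I / 2` with `I` finite and nonzero.
  have h4 := h (I / 2 / A) (ENNReal.div_pos (ENNReal.half_pos hne).ne' hA).ne'
  rw [ENNReal.mul_div_cancel hA0 hA] at h4
  exact (ENNReal.half_lt_self hne (ne_top_of_le_ne_top hA h1)).not_ge h4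

theorem lintegral_lintegral_le_of_le_segInt {C : Set R3} (hC : MeasurableSet C)
    (hconv : Convex ℝ C) {e F : R3 → ℝ≥0∞} (he : Measurable e) (hF : Measurable F) {L : ℝ≥0∞}
    {H : R3 → R3 → ℝ≥0∞} (hH : ∀ x ∈ C, ∀ y ∈ C, H x y ≤ e x + e y + L * segInt F x y) :
    ∫⁻ x in C, ∫⁻ y in C, H x y ≤
      2 * (volume C * ∫⁻ y in C, e y) + L * (8 * volume C * ∫⁻ y in C, F y) := by
  have hinner : ∀ x ∈ C, ∫⁻ y in C, H x y ≤ volume C * e x + (∫⁻ y in C, e y) +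
      L * ∫⁻ y in C, segInt F x y := by
    intro x hx
    have hsm : Measurable fun y => segInt F x y :=
      (measurable_segInt hF).comp measurable_prodMk_left
    refine (setLIntegral_mono' hC (hH x hx)).trans (le_of_eq ?_)
    rw [lintegral_add_right _ (hsm.const_mul _), lintegral_const_mul _ hsm,
      lintegral_add_right _ he, setLIntegral_const, mul_comm (e x)]
  have hsm : Measurable fun x => ∫⁻ y in C, segInt F x y :=
    (measurable_segInt hF).lintegral_prod_right'
  calc ∫⁻ x in C, ∫⁻ y in C, H x y ≤ ∫⁻ x in C, (volume C * e x + (∫⁻ y in C, e y) +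
        L * ∫⁻ y in C, segInt F x y) :=
        setLIntegral_mono' hC hinner
    _ = 2 * (volume C * ∫⁻ y in C, e y) + L * ∫⁻ x in C, ∫⁻ y in C, segInt F x y := by
        rw [lintegral_add_right _ (hsm.const_mul _), lintegral_const_mul _ hsm,
          lintegral_add_right _ measurable_const, setLIntegral_const, lintegral_const_mul _ he]
        ring
    _ ≤ _ := by
        gcongr
        exact lintegral_lintegral_segInt_le hC hconv hF

/-- Triangle inequality through a smooth `w`, whose increment is controlled along the `Φ`-image of
the segment, a curve with Lipschitz constant `K * D`. Replacing the derivatives of `w` by `g` leaves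
the first segment integral as an error. -/
theorem enorm_sub_le_segInt_add_error {w u : R3 → ℝ} {g : Fin 3 → R3 → ℝ}
    (hw : ContDiff ℝ (⊤ : ℕ∞) w) (hgm : ∀ i, Measurable (g i)) {Φ : R3 → R3} {K D : ℝ≥0}
    (hΦ : LipschitzWith K Φ) {x y : R3} (hxy : ‖y - x‖ ≤ D) :
    ‖u (Φ x) - u (Φ y)‖ₑ ≤ ‖w (Φ x) - u (Φ x)‖ₑ + ‖w (Φ y) - u (Φ y)‖ₑ + (K * D : ℝ≥0) *
      segInt (fun z => ∑ i, ‖partialDeriv i w (Φ z) - g i (Φ z)‖ₑ) x y +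
      (K * D : ℝ≥0) * segInt (fun z => ∑ i, ‖g i (Φ z)‖ₑ) x y := by
  have hγ : LipschitzWith (K * D) fun t : ℝ => Φ (x + t • (y - x)) := by
    refine hΦ.comp (LipschitzWith.of_dist_le_mul fun s t => ?_)
    rw [dist_add_left, dist_eq_norm, dist_eq_norm, ← sub_smul, norm_smul, mul_comm]
    gcongr
  have hseg := enorm_comp_sub_le_lintegral (hw.of_le (by simp)) hγ
  simp only [one_smul, zero_smul, add_zero, add_sub_cancel] at hseg
  have hΦm : Measurable Φ := hΦ.continuous.measurable
  have hGm : Measurable fun z => ∑ i, ‖g i (Φ z)‖ₑ :=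
    Finset.measurable_fun_sum _ fun i _ => ((hgm i).comp hΦm).enorm
  have hl : Measurable fun t : ℝ => x + t • (y - x) := by fun_prop
  have hsum : ∫⁻ t in Set.Ioo (0 : ℝ) 1, ∑ i, ‖partialDeriv i w (Φ (x + t • (y - x)))‖ₑ ≤
      segInt (fun z => ∑ i, ‖partialDeriv i w (Φ z) - g i (Φ z)‖ₑ) x y +
        segInt (fun z => ∑ i, ‖g i (Φ z)‖ₑ) x y := by
    unfold segInt
    have hGl : Measurable fun t : ℝ => ∑ i, ‖g i (Φ (x + t • (y - x)))‖ₑ := hGm.comp hl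
    rw [← lintegral_add_right _ hGl]
    refine lintegral_mono fun t => ?_
    dsimp only
    rw [← Finset.sum_add_distrib]
    refine Finset.sum_le_sum fun i _ => ?_
    have := enorm_add_le (partialDeriv i w (Φ (x + t • (y - x))) - g i (Φ (x + t • (y - x))))
      (g i (Φ (x + t • (y - x))))
    rwa [sub_add_cancel] at this
  have htri : ‖u (Φ x) - u (Φ y)‖ₑ ≤ ‖w (Φ x) - u (Φ x)‖ₑ + ‖w (Φ y) - w (Φ x)‖ₑ +
      ‖w (Φ y) - u (Φ y)‖ₑ := by
    have h3 : u (Φ x) - u (Φ y) = -(w (Φ x) - u (Φ x)) + -(w (Φ y) - w (Φ x)) +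
      (w (Φ y) - u (Φ y)) := by ring
    rw [h3]
    refine (enorm_add_le _ _).trans (add_le_add_left ?_ _)
    refine (enorm_add_le _ _).trans ?_
    rw [enorm_neg, enorm_neg]
  refine htri.trans ?_
  refine (add_le_add_left (add_le_add_right (hseg.trans (mul_le_mul_right hsum _)) _) _).trans ?_
  rw [mul_add]
  apply le_of_eq
  ring

/-- Since `Φ '' C` is compact in `Ω`, smooth approximants exist there. They show that the excess of
the left side over the right has double integral at most `A * ε` for every `ε`, so it vanishes
almost everywhere without extracting a convergent subsequence. -/
theorem ae_enorm_sub_le_segInt_of_isCompact {Ω : Set R3} (hΩ : IsOpen Ω) {u : R3 → ℝ}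
    {g : Fin 3 → R3 → ℝ} (hum : Measurable u) (hgm : ∀ i, Measurable (g i))
    (hu : MemLp u 2 (volume.restrict Ω)) (hg : ∀ i, MemLp (g i) 2 (volume.restrict Ω))
    (hug : ∀ i, IsWeakDeriv Ω (Pi.single i 1) u (g i))
    {C : Set R3} (hC : IsCompact C) (hconv : Convex ℝ C) {D : ℝ≥0}
    (hD : ∀ x ∈ C, ∀ y ∈ C, ‖y - x‖ ≤ D) {Φ : R3 → R3} {K : ℝ≥0} (hΦ : LipschitzWith K Φ)
    (hΦC : Φ '' C ⊆ Ω) {c : ℝ≥0∞} (hc : c ≠ ∞)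
    (hcv : ∀ f : R3 → ℝ≥0∞, Measurable f → ∫⁻ x in C, f (Φ x) ≤ c * ∫⁻ y in Φ '' C, f y) :
    ∀ᵐ x ∂volume.restrict C, ∀ᵐ y ∂volume.restrict C, ‖u (Φ x) - u (Φ y)‖ₑ ≤
      (K * D : ℝ≥0) * segInt (fun z => ∑ i, ‖g i (Φ z)‖ₑ) x y := by
  have hΦm : Measurable Φ := hΦ.continuous.measurable
  set G : R3 → ℝ≥0∞ := fun z => ∑ i, ‖g i (Φ z)‖ₑ with hGdef
  have hGm : Measurable G := Finset.measurable_fun_sum _ fun i _ => ((hgm i).comp hΦm).enorm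
  -- Subtraction in `ℝ≥0∞` truncates, so `H x y = 0` is exactly the desired inequality.
  set H : R3 → R3 → ℝ≥0∞ := fun x y =>
    ‖u (Φ x) - u (Φ y)‖ₑ - (K * D : ℝ≥0) * segInt G x y with hHdef
  have hHm : Measurable (Function.uncurry H) := by
    have h1 := hum.comp hΦm
    exact (((h1.comp measurable_fst).sub (h1.comp measurable_snd)).enorm).sub
      ((measurable_segInt hGm).const_mul _)
  -- The first term collects the errors of `w` at both endpoints, the second those of its three
  -- partial derivatives along the segment.
  set A : ℝ≥0∞ := 2 * (volume C * c) + (K * D : ℝ≥0) * (8 * volume C * (3 * c)) with hAdef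
  have hvC : volume C ≠ ∞ := hC.measure_ne_top
  have hA : A ≠ ∞ := by
    refine ENNReal.add_ne_top.2 ⟨?_, ?_⟩ <;>
    · repeat' refine ENNReal.mul_ne_top ?_ ?_
      all_goals first | assumption | exact ENNReal.coe_ne_top
  have hbound : ∀ ε : ℝ≥0∞, ε ≠ 0 → ∫⁻ x in C, ∫⁻ y in C, H x y ≤ A * ε := by
    intro ε hε
    obtain ⟨w, hw, h1, h2⟩ := exists_contDiff_approx_L1 hΩ (hC.image hΦ.continuous) hΦC hum hgm
      hu hg hug hε
    have hwm := hw.continuous.measurable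
    have hwdm := fun i => (contDiff_partialDeriv hw i).continuous.measurable
    set e : R3 → ℝ≥0∞ := fun x => ‖w (Φ x) - u (Φ x)‖ₑ with hedef
    have hem : Measurable e := ((hwm.comp hΦm).sub (hum.comp hΦm)).enorm
    set F : R3 → ℝ≥0∞ := fun z => ∑ i, ‖partialDeriv i w (Φ z) - g i (Φ z)‖ₑ with hFdef
    have hFm : Measurable F := Finset.measurable_fun_sum _ fun i _ =>
      (((hwdm i).comp hΦm).sub ((hgm i).comp hΦm)).enorm
    have he : ∫⁻ x in C, e x ≤ c * ε :=
      (hcv (fun y => ‖w y - u y‖ₑ) (hwm.sub hum).enorm).trans (by gcongr)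
    have hF : ∫⁻ x in C, F x ≤ 3 * c * ε := by
      have hFi : ∀ i, Measurable fun z => ‖partialDeriv i w (Φ z) - g i (Φ z)‖ₑ := fun i =>
        (((hwdm i).comp hΦm).sub ((hgm i).comp hΦm)).enorm
      rw [hFdef, lintegral_finsetSum _ fun i _ => hFi i]
      refine (Finset.sum_le_sum fun i _ => (hcv (fun y => ‖partialDeriv i w y - g i y‖ₑ)
        ((hwdm i).sub (hgm i)).enorm).trans (mul_le_mul_right (h2 i) c)).trans ?_
      simp [mul_assoc]
    refine (lintegral_lintegral_le_of_le_segInt hC.measurableSet hconv hem hFm (L := (K * D : ℝ≥0))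
      fun x hx y hy => tsub_le_iff_right.2
        (enorm_sub_le_segInt_add_error hw hgm hΦ (hD x hx y hy))).trans ?_
    calc _ ≤ 2 * (volume C * (c * ε)) + (K * D : ℝ≥0) * (8 * volume C * (3 * c * ε)) := by
          gcongr
      _ = A * ε := by rw [hAdef]; ring
  have hzero := eq_zero_of_forall_le_mul hA hbound
  have hm1 : Measurable fun x => ∫⁻ y in C, H x y :=
    hHm.lintegral_prod_right'
  rw [lintegral_eq_zero_iff hm1] at hzero
  filter_upwards [hzero] with x hx
  have hm2 : Measurable fun y => H x y := hHm.comp measurable_prodMk_left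
  have hx' := (lintegral_eq_zero_iff hm2).1 hx
  filter_upwards [hx'] with y hy
  exact tsub_eq_zero_iff_le.1 hy

/-! ### From the segment inequality to `L^∞` and `L⁴` -/

theorem lintegral_Ioo_rpow_ne_top {s : ℝ} (hs : -1 < s) :
    ∫⁻ t in Set.Ioo (0 : ℝ) 1, ENNReal.ofReal (t ^ s) ≠ ∞ := by
  have h := (intervalIntegral.integrableOn_Ioo_rpow_iff (s := s) one_pos).2 hs
  exact h.lintegral_lt_top.ne

/-- Hölder's inequality for `t^(5/6) F` against `t^(-5/6) dt`. A weight `tˢ` on the right works here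
for `s < 3`, and `t^(s-3)` is integrable for `s > 2`; `5/2` lies between. -/
theorem exists_pow_four_lintegral_Ioo_le : ∃ A : ℝ≥0∞, A ≠ ∞ ∧ ∀ F : ℝ → ℝ≥0∞, Measurable F →
    (∫⁻ t in Set.Ioo (0 : ℝ) 1, F t) ^ 4 ≤
      A * ∫⁻ t in Set.Ioo (0 : ℝ) 1, ENNReal.ofReal (t ^ (5 / 2 : ℝ)) * F t ^ 4 := by
  have hm : ∀ s : ℝ, Measurable fun t : ℝ => ENNReal.ofReal (t ^ s) := fun s => by fun_prop
  refine ⟨(∫⁻ t in Set.Ioo (0 : ℝ) 1, ENNReal.ofReal (t ^ (-5 / 6 : ℝ))) ^ 3,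
    ENNReal.pow_ne_top (lintegral_Ioo_rpow_ne_top (by norm_num)), fun F hF => ?_⟩
  have hf : Measurable fun t => ENNReal.ofReal (t ^ (5 / 6 : ℝ)) * F t := (hm _).mul hF
  have h := pow_four_lintegral_le ((volume.restrict (Set.Ioo (0 : ℝ) 1)).withDensity
    fun t => ENNReal.ofReal (t ^ (-5 / 6 : ℝ))) hf.aemeasurable
  rw [lintegral_withDensity_eq_lintegral_mul _ (hm _) hf,
    lintegral_withDensity_eq_lintegral_mul _ (hm _) (hf.pow_const 4), withDensity_apply _ .univ,
    setLIntegral_univ] at h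
  refine le_of_eq_of_le ?_ (h.trans (le_of_eq ?_))
  · congr 1
    refine setLIntegral_congr_fun measurableSet_Ioo fun t ht => ?_
    simp only [Pi.mul_apply]
    rw [← mul_assoc, ← ENNReal.ofReal_mul (Real.rpow_nonneg ht.1.le _), ← Real.rpow_add ht.1]
    norm_num
  · congr 1
    refine setLIntegral_congr_fun measurableSet_Ioo fun t ht => ?_
    simp only [Pi.mul_apply]
    rw [mul_pow, ← mul_assoc, ← ENNReal.ofReal_pow (Real.rpow_nonneg ht.1.le _),
      ← ENNReal.ofReal_mul (Real.rpow_nonneg ht.1.le _), ← Real.rpow_mul_natCast ht.1.le,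
      ← Real.rpow_add ht.1]
    norm_num

theorem ofReal_rpow_mul_inv_pow {t : ℝ} (ht : 0 < t) :
    ENNReal.ofReal (t ^ (5 / 2 : ℝ)) * ENNReal.ofReal (t⁻¹ ^ 3) =
      ENNReal.ofReal (t ^ (-1 / 2 : ℝ)) := by
  rw [← ENNReal.ofReal_mul (by positivity)]
  congr 1
  rw [← Real.rpow_neg_one, ← Real.rpow_mul_natCast ht.le, ← Real.rpow_add ht]
  norm_num

/-- Integrate `|v x| ≤ |v y| + |v x - v y|` over `y ∈ C` and exchange the `y` and `t` integrals. -/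
theorem ae_volume_mul_enorm_le {C : Set R3} {v : R3 → ℝ} {G : R3 → ℝ≥0∞} {L : ℝ≥0∞}
    (hv : Measurable v) (hG : Measurable G)
    (h : ∀ᵐ x ∂volume.restrict C, ∀ᵐ y ∂volume.restrict C, ‖v x - v y‖ₑ ≤ L * segInt G x y) :
    ∀ᵐ x ∂volume.restrict C, volume C * ‖v x‖ₑ ≤ (∫⁻ y in C, ‖v y‖ₑ) +
      L * ∫⁻ t in Set.Ioo (0 : ℝ) 1, ∫⁻ y in C, G (x + t • (y - x)) := by
  filter_upwards [h] with x hx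
  have hsm : Measurable fun y => segInt G x y := (measurable_segInt hG).comp measurable_prodMk_left
  have hsw : ∫⁻ t in Set.Ioo (0 : ℝ) 1, ∫⁻ y in C, G (x + t • (y - x)) =
      ∫⁻ y in C, segInt G x y :=
    lintegral_lintegral_swap (Measurable.aemeasurable (by fun_prop))
  rw [hsw, mul_comm, ← setLIntegral_const, ← lintegral_const_mul _ hsm,
    ← lintegral_add_left hv.enorm]
  refine lintegral_mono_ae ?_
  filter_upwards [hx] with y hy
  have := enorm_add_le (v y) (v x - v y)
  rw [add_sub_cancel] at this
  exact this.trans (by gcongr)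

/-- A Morrey-type bound: the fourth power of the inner integral over `y` is at most `|C|³ t⁻³ ∫ G⁴`,
and the weight `t^(5/2)` makes this integrable in `t`, uniformly in `x`. -/
theorem exists_ae_enorm_le_of_segInt {C : Set R3} (hC : MeasurableSet C) (hconv : Convex ℝ C)
    (hCv : volume C ≠ ∞) {v : R3 → ℝ} {G : R3 → ℝ≥0∞} {L : ℝ≥0∞} (hL : L ≠ ∞)
    (hv : Measurable v) (hG : Measurable G) (hvi : ∫⁻ y in C, ‖v y‖ₑ ≠ ∞)
    (hGi : ∫⁻ y in C, G y ^ 4 ≠ ∞)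
    (h : ∀ᵐ x ∂volume.restrict C, ∀ᵐ y ∂volume.restrict C, ‖v x - v y‖ₑ ≤ L * segInt G x y) :
    ∃ M : ℝ≥0∞, M ≠ ∞ ∧ ∀ᵐ x ∂volume.restrict C, ‖v x‖ₑ ≤ M := by
  rcases eq_or_ne (volume C) 0 with hC0 | hC0
  · refine ⟨0, by simp, ?_⟩
    rw [Measure.restrict_eq_zero.2 hC0]
    simp
  obtain ⟨A, hA, hAF⟩ := exists_pow_four_lintegral_Ioo_le
  set N := ∫⁻ y in C, G y ^ 4
  set J := ∫⁻ t in Set.Ioo (0 : ℝ) 1, ENNReal.ofReal (t ^ (-1 / 2 : ℝ))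
  have hJ : J ≠ ∞ := lintegral_Ioo_rpow_ne_top (by norm_num)
  set P := A * (volume C ^ 3 * N * J) with hP
  have hPt : P ≠ ∞ := ENNReal.mul_ne_top hA (ENNReal.mul_ne_top
    (ENNReal.mul_ne_top (ENNReal.pow_ne_top hCv) hGi) hJ)
  have hseg : ∀ x ∈ C, (∫⁻ t in Set.Ioo (0 : ℝ) 1, ∫⁻ y in C, G (x + t • (y - x))) ^ 4 ≤ P := by
    intro x hx
    have hFm : Measurable fun t : ℝ => ∫⁻ y in C, G (x + t • (y - x)) := by
      have hm : Measurable fun p : ℝ × R3 => G (x + p.1 • (p.2 - x)) := by fun_prop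
      exact hm.lintegral_prod_right' (ν := volume.restrict C)
    refine (hAF _ hFm).trans ?_
    rw [hP]
    gcongr A * ?_
    rw [← lintegral_const_mul _ (by fun_prop)]
    refine setLIntegral_mono' measurableSet_Ioo fun t ht => ?_
    have h1 := pow_four_lintegral_le (volume.restrict C) (f := fun y => G (x + t • (y - x)))
      (Measurable.aemeasurable (by fun_prop))
    rw [Measure.restrict_apply_univ] at h1
    have h2 := setLIntegral_segment_le hC hconv (fun z => G z ^ 4) hx ht
    rw [← ofReal_rpow_mul_inv_pow ht.1]
    calc _ ≤ ENNReal.ofReal (t ^ (5 / 2 : ℝ)) *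
          (volume C ^ 3 * (ENNReal.ofReal (t⁻¹ ^ 3) * N)) := by
          gcongr
          exact h1.trans (by gcongr)
      _ = _ := by ring
  refine ⟨((∫⁻ y in C, ‖v y‖ₑ) + L * (P + 1)) / volume C, ENNReal.div_ne_top
    (ENNReal.add_ne_top.2 ⟨hvi, ENNReal.mul_ne_top hL (by simp [hPt])⟩) hC0, ?_⟩
  filter_upwards [ae_volume_mul_enorm_le hv hG h, ae_restrict_mem hC] with x hx hxC
  rw [ENNReal.le_div_iff_mul_le (.inl hC0) (.inl hCv), mul_comm]
  refine hx.trans ?_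
  gcongr
  -- `P + 1` stands in for the fourth root of `P`, since `P ≤ (P + 1)⁴`.
  refine (ENNReal.pow_le_pow_left_iff (n := 4) (by norm_num)).1 ((hseg x hxC).trans ?_)
  exact le_self_add.trans (le_self_pow (by simp) (by norm_num))

/-- By Cauchy–Schwarz the fourth power of the inner integral is at most `|C|² S²`, with `S` the
integral of `G²` along the segments. One factor `S` is bounded pointwise by `t⁻³ ∫ G²`; the other is
integrated in `x`, where the bound `8 |C| ∫ G²` has no singularity in `t`. -/
theorem lintegral_pow_four_ne_top_of_segInt {C : Set R3} (hC : MeasurableSet C)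
    (hconv : Convex ℝ C) (hCv : volume C ≠ ∞) {v : R3 → ℝ} {G : R3 → ℝ≥0∞} {L : ℝ≥0∞}
    (hL : L ≠ ∞) (hv : Measurable v) (hG : Measurable G) (hvi : ∫⁻ y in C, ‖v y‖ₑ ≠ ∞)
    (hGi : ∫⁻ y in C, G y ^ 2 ≠ ∞)
    (h : ∀ᵐ x ∂volume.restrict C, ∀ᵐ y ∂volume.restrict C, ‖v x - v y‖ₑ ≤ L * segInt G x y) :
    ∫⁻ x in C, ‖v x‖ₑ ^ 4 ≠ ∞ := by
  rcases eq_or_ne (volume C) 0 with hC0 | hC0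
  · rw [Measure.restrict_eq_zero.2 hC0]
    simp
  obtain ⟨A, hA, hAF⟩ := exists_pow_four_lintegral_Ioo_le
  set N := ∫⁻ y in C, G y ^ 2 with hN
  set J := ∫⁻ t in Set.Ioo (0 : ℝ) 1, ENNReal.ofReal (t ^ (-1 / 2 : ℝ)) with hJdef
  have hJ : J ≠ ∞ := lintegral_Ioo_rpow_ne_top (by norm_num)
  have hG2 : Measurable fun z => G z ^ 2 := hG.pow_const 2
  set S : R3 → ℝ → ℝ≥0∞ := fun x t => ∫⁻ y in C, G (x + t • (y - x)) ^ 2 with hS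
  have hSm : Measurable (Function.uncurry S) := by
    have hm : Measurable fun p : (R3 × ℝ) × R3 => G (p.1.1 + p.1.2 • (p.2 - p.1.1)) ^ 2 := by
      fun_prop
    exact hm.lintegral_prod_right' (ν := volume.restrict C)
  have hFm : Measurable fun p : R3 × ℝ => ∫⁻ y in C, G (p.1 + p.2 • (y - p.1)) := by
    have hm : Measurable fun p : (R3 × ℝ) × R3 => G (p.1.1 + p.1.2 • (p.2 - p.1.1)) := by
      fun_prop
    exact hm.lintegral_prod_right' (ν := volume.restrict C)
  have hPm : Measurable fun x => ∫⁻ t in Set.Ioo (0 : ℝ) 1, ∫⁻ y in C, G (x + t • (y - x)) :=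
    hFm.lintegral_prod_right'
  have hpt : ∀ x ∈ C, (∫⁻ t in Set.Ioo (0 : ℝ) 1, ∫⁻ y in C, G (x + t • (y - x))) ^ 4 ≤
      A * ∫⁻ t in Set.Ioo (0 : ℝ) 1,
        volume C ^ 2 * N * (ENNReal.ofReal (t ^ (-1 / 2 : ℝ)) * S x t) := by
    intro x hx
    refine (hAF _ (hFm.comp measurable_prodMk_left)).trans ?_
    gcongr A * ?_
    refine setLIntegral_mono' measurableSet_Ioo fun t ht => ?_
    have h1 := sq_lintegral_le (volume.restrict C) (f := fun y => G (x + t • (y - x)))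
      (Measurable.aemeasurable (by fun_prop))
    rw [Measure.restrict_apply_univ] at h1
    have h2 : S x t ≤ _ := setLIntegral_segment_le hC hconv (fun z => G z ^ 2) hx ht
    rw [← ofReal_rpow_mul_inv_pow ht.1]
    calc ENNReal.ofReal (t ^ (5 / 2 : ℝ)) * (∫⁻ y in C, G (x + t • (y - x))) ^ 4
        = ENNReal.ofReal (t ^ (5 / 2 : ℝ)) * ((∫⁻ y in C, G (x + t • (y - x))) ^ 2) ^ 2 := by ring
      _ ≤ ENNReal.ofReal (t ^ (5 / 2 : ℝ)) * (volume C * S x t) ^ 2 := by gcongr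
      _ = ENNReal.ofReal (t ^ (5 / 2 : ℝ)) * volume C ^ 2 * (S x t * S x t) := by ring
      _ ≤ ENNReal.ofReal (t ^ (5 / 2 : ℝ)) * volume C ^ 2 *
          ((ENNReal.ofReal (t⁻¹ ^ 3) * N) * S x t) := by gcongr
      _ = _ := by ring
  have hmeas : Measurable fun p : R3 × ℝ =>
      volume C ^ 2 * N * (ENNReal.ofReal (p.2 ^ (-1 / 2 : ℝ)) * S p.1 p.2) :=
    ((show Measurable fun p : R3 × ℝ => ENNReal.ofReal (p.2 ^ (-1 / 2 : ℝ)) by fun_prop).mul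
      hSm).const_mul _
  have hP : ∫⁻ x in C, (∫⁻ t in Set.Ioo (0 : ℝ) 1, ∫⁻ y in C, G (x + t • (y - x))) ^ 4 ≤
      A * (volume C ^ 2 * N * (8 * volume C * N) * J) := by
    refine (setLIntegral_mono' hC hpt).trans ?_
    have hIm : Measurable fun x => ∫⁻ t in Set.Ioo (0 : ℝ) 1,
        volume C ^ 2 * N * (ENNReal.ofReal (t ^ (-1 / 2 : ℝ)) * S x t) :=
      hmeas.lintegral_prod_right'
    rw [lintegral_const_mul _ hIm, lintegral_lintegral_swap
      hmeas.aemeasurable]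
    refine mul_le_mul_right ?_ A
    have hrm : Measurable fun t : ℝ => ENNReal.ofReal (t ^ (-1 / 2 : ℝ)) := by fun_prop
    rw [hJdef, ← lintegral_const_mul _ hrm]
    refine setLIntegral_mono' measurableSet_Ioo fun t ht => ?_
    have hSt : Measurable fun x => S x t := hSm.comp measurable_prodMk_right
    rw [lintegral_const_mul _ (hSt.const_mul _), lintegral_const_mul _ hSt]
    calc _ ≤ volume C ^ 2 * N * (ENNReal.ofReal (t ^ (-1 / 2 : ℝ)) * (8 * volume C * N)) := by
          gcongr
          exact lintegral_lintegral_segment_le hC hconv hG2 ht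
      _ = _ := by ring
  have hPt : ∫⁻ x in C, (∫⁻ t in Set.Ioo (0 : ℝ) 1, ∫⁻ y in C, G (x + t • (y - x))) ^ 4 ≠ ∞ := by
    refine ne_top_of_le_ne_top ?_ hP
    repeat' refine ENNReal.mul_ne_top ?_ ?_
    all_goals first | assumption | exact ENNReal.pow_ne_top hCv | norm_num
  have hle : volume C ^ 4 * ∫⁻ x in C, ‖v x‖ₑ ^ 4 ≤ 8 * ((∫⁻ y in C, ‖v y‖ₑ) ^ 4 * volume C +
      L ^ 4 * ∫⁻ x in C, (∫⁻ t in Set.Ioo (0 : ℝ) 1, ∫⁻ y in C, G (x + t • (y - x))) ^ 4) := by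
    rw [← lintegral_const_mul _ (hv.enorm.pow_const 4), ← lintegral_const_mul _ (hPm.pow_const 4),
      ← setLIntegral_const, ← lintegral_add_left measurable_const,
      ← lintegral_const_mul _ (by fun_prop)]
    refine lintegral_mono_ae ?_
    filter_upwards [ae_volume_mul_enorm_le hv hG h] with x hx
    rw [← mul_pow, ← mul_pow]
    refine (pow_le_pow_left₀ (zero_le) hx 4).trans ?_
    have h4 := ENNReal.rpow_add_le_mul_rpow_add_rpow (∫⁻ y in C, ‖v y‖ₑ)
      (L * ∫⁻ t in Set.Ioo (0 : ℝ) 1, ∫⁻ y in C, G (x + t • (y - x))) (p := (4 : ℕ)) (by norm_num)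
    simp only [ENNReal.rpow_natCast] at h4
    refine h4.trans (le_of_eq ?_)
    congr 1
    rw [show ((4 : ℕ) : ℝ) - 1 = (3 : ℕ) by norm_num, ENNReal.rpow_natCast]
    norm_num
  have hfin : volume C ^ 4 * ∫⁻ x in C, ‖v x‖ₑ ^ 4 ≠ ∞ := by
    refine ne_top_of_le_ne_top ?_ hle
    refine ENNReal.mul_ne_top (by norm_num) (ENNReal.add_ne_top.2 ⟨?_, ?_⟩)
    · exact ENNReal.mul_ne_top (ENNReal.pow_ne_top hvi) hCv
    · exact ENNReal.mul_ne_top (ENNReal.pow_ne_top hL) hPt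
  intro htop
  rw [htop, ENNReal.mul_top (pow_ne_zero 4 hC0)] at hfin
  exact hfin rfl

/-! ### Bi-Lipschitz changes of variables -/

/-- Lebesgue measure is a multiple of three-dimensional Hausdorff measure, which a `K`-Lipschitz map
enlarges by at most `K³`. -/
theorem volume_image_le_of_lipschitzWith {f : R3 → R3} {K : ℝ≥0} (hf : LipschitzWith K f)
    (s : Set R3) : volume (f '' s) ≤ (K : ℝ≥0∞) ^ 3 * volume s := by
  have hH : (Measure.hausdorffMeasure 3 : Measure R3).IsAddHaarMeasure := by
    simpa using isAddHaarMeasure_hausdorffMeasure (E := R3)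
  obtain ⟨a, ha⟩ : ∃ a : ℝ≥0, (volume : Measure R3) = a • Measure.hausdorffMeasure 3 :=
    ⟨_, Measure.isAddLeftInvariant_eq_smul _ _⟩
  have h1 := hf.hausdorffMeasure_image_le (d := 3) (by norm_num) s
  have hK : (K : ℝ≥0∞) ^ (3 : ℝ) = (K : ℝ≥0∞) ^ 3 := by exact_mod_cast ENNReal.rpow_natCast K 3
  rw [hK] at h1
  simp only [ha, Measure.smul_apply, ENNReal.smul_def, smul_eq_mul]
  calc _ ≤ (a : ℝ≥0∞) * ((K : ℝ≥0∞) ^ 3 * Measure.hausdorffMeasure 3 s) := by gcongr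
    _ = _ := by ring

/-- The part of `C` sent into `E` is contained in the `Ψ`-image of `E ∩ Φ '' C`, so the Lipschitz
bound on the inverse applies. -/
theorem map_restrict_le {Φ Ψ : R3 → R3} {K : ℝ≥0} (hΦ : LipschitzWith K Φ)
    (hΨ : LipschitzWith K Ψ) {C : Set R3} (hinv : Set.LeftInvOn Ψ Φ C) :
    (volume.restrict C).map Φ ≤ (K : ℝ≥0∞) ^ 3 • volume.restrict (Φ '' C) := by
  refine Measure.le_iff.2 fun E hE => ?_
  rw [Measure.map_apply hΦ.continuous.measurable hE,
    Measure.restrict_apply (hΦ.continuous.measurable hE), Measure.smul_apply,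
    Measure.restrict_apply hE, smul_eq_mul]
  refine (measure_mono ?_).trans (volume_image_le_of_lipschitzWith hΨ _)
  rintro x ⟨hxE, hxC⟩
  exact ⟨Φ x, ⟨hxE, x, hxC, rfl⟩, hinv hxC⟩

theorem restrict_image_le {Φ : R3 → R3} {K : ℝ≥0} (hΦ : LipschitzWith K Φ) (C : Set R3) :
    volume.restrict (Φ '' C) ≤ (K : ℝ≥0∞) ^ 3 • (volume.restrict C).map Φ := by
  refine Measure.le_iff.2 fun E hE => ?_
  rw [Measure.smul_apply, Measure.map_apply hΦ.continuous.measurable hE,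
    Measure.restrict_apply (hΦ.continuous.measurable hE),
    Measure.restrict_apply hE, smul_eq_mul]
  refine (measure_mono ?_).trans (volume_image_le_of_lipschitzWith hΦ _)
  rintro _ ⟨hxE, x, hxC, rfl⟩
  exact ⟨x, ⟨hxE, hxC⟩, rfl⟩

theorem setLIntegral_comp_le {Φ Ψ : R3 → R3} {K : ℝ≥0} (hΦ : LipschitzWith K Φ)
    (hΨ : LipschitzWith K Ψ) {C : Set R3} (hinv : Set.LeftInvOn Ψ Φ C) {f : R3 → ℝ≥0∞}
    (hf : Measurable f) :
    ∫⁻ x in C, f (Φ x) ≤ (K : ℝ≥0∞) ^ 3 * ∫⁻ y in Φ '' C, f y := by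
  rw [← lintegral_map hf hΦ.continuous.measurable, ← smul_eq_mul, ← lintegral_smul_measure]
  exact lintegral_mono' (map_restrict_le hΦ hΨ hinv) le_rfl

theorem setLIntegral_image_le {Φ : R3 → R3} {K : ℝ≥0} (hΦ : LipschitzWith K Φ) {C : Set R3}
    {f : R3 → ℝ≥0∞} (hf : Measurable f) :
    ∫⁻ y in Φ '' C, f y ≤ (K : ℝ≥0∞) ^ 3 * ∫⁻ x in C, f (Φ x) := by
  rw [← lintegral_map hf hΦ.continuous.measurable, ← smul_eq_mul, ← lintegral_smul_measure]
  exact lintegral_mono' (restrict_image_le hΦ C) le_rfl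

/-! ### Convex charts and a finite atlas -/

/-- A bi-Lipschitz chart of `Ω` on a bounded convex set that is exhausted by compact convex sets. -/
structure ConvexChart (Ω : Set R3) where
  /-- The convex domain of the chart. -/
  dom : Set R3
  /-- The compact convex exhaustion of the domain. -/
  exhaust : ℕ → Set R3
  /-- The chart map, extended to the whole space. -/
  toFun : R3 → R3
  /-- The inverse of the chart map, extended to the whole space. -/
  inv : R3 → R3
  /-- A common Lipschitz constant of the chart map and its inverse. -/
  K : ℝ≥0
  /-- A bound for the diameter of the domain. -/
  D : ℝ≥0
  isCompact_exhaust : ∀ n, IsCompact (exhaust n)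
  convex_exhaust : ∀ n, Convex ℝ (exhaust n)
  monotone_exhaust : Monotone exhaust
  iUnion_exhaust : ⋃ n, exhaust n = dom
  convex_dom : Convex ℝ dom
  norm_sub_le : ∀ x ∈ dom, ∀ y ∈ dom, ‖y - x‖ ≤ D
  lipschitz_toFun : LipschitzWith K toFun
  lipschitz_inv : LipschitzWith K inv
  leftInvOn : Set.LeftInvOn inv toFun dom
  image_subset : toFun '' dom ⊆ Ω

namespace ConvexChart
variable {Ω : Set R3} (c : ConvexChart Ω)

theorem measurableSet_dom : MeasurableSet c.dom := by
  rw [← c.iUnion_exhaust]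
  exact .iUnion fun n => (c.isCompact_exhaust n).measurableSet

theorem volume_dom_ne_top : volume c.dom ≠ ∞ := by
  have : Bornology.IsBounded c.dom := by
    refine Metric.isBounded_iff.2 ⟨c.D, fun x hx y hy => ?_⟩
    rw [dist_comm, dist_eq_norm]
    exact c.norm_sub_le x hx y hy
  exact this.measure_lt_top.ne

/-- Any two points of the domain lie in a common compact piece, because the exhaustion is monotone;
countably many null sets are discarded. -/
theorem ae_enorm_sub_le_segInt (hΩ : IsOpen Ω) {u : R3 → ℝ}
    {g : Fin 3 → R3 → ℝ} (hum : Measurable u) (hgm : ∀ i, Measurable (g i))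
    (hu : MemLp u 2 (volume.restrict Ω)) (hg : ∀ i, MemLp (g i) 2 (volume.restrict Ω))
    (hug : ∀ i, IsWeakDeriv Ω (Pi.single i 1) u (g i)) :
    ∀ᵐ x ∂volume.restrict c.dom, ∀ᵐ y ∂volume.restrict c.dom,
      ‖u (c.toFun x) - u (c.toFun y)‖ₑ ≤
        (c.K * c.D : ℝ≥0) * segInt (fun z => ∑ i, ‖g i (c.toFun z)‖ₑ) x y := by
  have hsub : ∀ n, c.exhaust n ⊆ c.dom := fun n => by
    rw [← c.iUnion_exhaust]; exact Set.subset_iUnion _ n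
  have h := fun n => ae_enorm_sub_le_segInt_of_isCompact hΩ hum hgm hu hg hug
    (c.isCompact_exhaust n) (c.convex_exhaust n)
    (fun x hx y hy => c.norm_sub_le x (hsub n hx) y (hsub n hy)) c.lipschitz_toFun
    ((Set.image_mono (hsub n)).trans c.image_subset)
    (c := (c.K : ℝ≥0∞) ^ 3) (by simp)
    (fun f hf => setLIntegral_comp_le c.lipschitz_toFun c.lipschitz_inv
      (c.leftInvOn.mono (hsub n)) hf)
  have hms := fun n => (c.isCompact_exhaust n).measurableSet
  rw [ae_restrict_iff' c.measurableSet_dom]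
  filter_upwards [ae_all_iff.2 fun n => (ae_restrict_iff' (hms n)).1 (h n)] with x hx hxC
  rw [← c.iUnion_exhaust] at hxC
  obtain ⟨k, hk⟩ := Set.mem_iUnion.1 hxC
  rw [ae_restrict_iff' c.measurableSet_dom]
  have hx' : ∀ n, ∀ᵐ y, y ∈ c.exhaust (max k n) → _ := fun n =>
    (ae_restrict_iff' (hms _)).1 (hx (max k n) (c.monotone_exhaust (le_max_left k n) hk))
  filter_upwards [ae_all_iff.2 hx'] with y hy hyC
  rw [← c.iUnion_exhaust] at hyC
  obtain ⟨n, hn⟩ := Set.mem_iUnion.1 hyC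
  exact hy n (c.monotone_exhaust (le_max_right k n) hn)

theorem lintegral_comp_ne_top {f : R3 → ℝ≥0∞} (hf : Measurable f)
    (h : ∫⁻ x in Ω, f x ≠ ∞) : ∫⁻ x in c.dom, f (c.toFun x) ≠ ∞ := by
  refine ne_top_of_le_ne_top ?_
    (setLIntegral_comp_le c.lipschitz_toFun c.lipschitz_inv c.leftInvOn hf)
  refine ENNReal.mul_ne_top (by simp) (ne_top_of_le_ne_top h ?_)
  exact lintegral_mono_set c.image_subset

theorem lintegral_sum_pow_ne_top {g : Fin 3 → R3 → ℝ} (hgm : ∀ i, Measurable (g i)) {n : ℕ}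
    (hn : n ≠ 0) (hg : ∀ i, MemLp (g i) n (volume.restrict Ω)) :
    ∫⁻ x in c.dom, (∑ i, ‖g i (c.toFun x)‖ₑ) ^ n ≠ ∞ := by
  refine c.lintegral_comp_ne_top (f := fun x => (∑ i, ‖g i x‖ₑ) ^ n)
    ((Finset.measurable_fun_sum _ fun i _ => (hgm i).enorm).pow_const n) ?_
  have h1 : MemLp (fun x => ∑ i, ‖g i x‖) n (volume.restrict Ω) :=
    memLp_finsetSum _ fun i _ => (hg i).norm
  have h2 : ∀ x, (∑ i, ‖g i x‖ₑ) = ‖∑ i, ‖g i x‖‖ₑ := by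
    intro x
    rw [Real.enorm_of_nonneg (Finset.sum_nonneg fun _ _ => norm_nonneg _),
      ENNReal.ofReal_sum_of_nonneg fun _ _ => norm_nonneg _]
    simp only [ofReal_norm]
  simp only [h2]
  rw [lintegral_enorm_pow_eq _ hn]
  exact ENNReal.pow_ne_top h1.2.ne

theorem lintegral_enorm_comp_ne_top {u : R3 → ℝ} (hum : Measurable u)
    (hu : MemLp u 2 (volume.restrict Ω)) : ∫⁻ x in c.dom, ‖u (c.toFun x)‖ₑ ≠ ∞ := by
  have h2 : ∫⁻ x in c.dom, ‖u (c.toFun x)‖ₑ ^ 2 ≠ ∞ := by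
    refine c.lintegral_comp_ne_top (f := fun x => ‖u x‖ₑ ^ 2) (hum.enorm.pow_const 2) ?_
    rw [lintegral_enorm_pow_eq _ two_ne_zero]
    exact ENNReal.pow_ne_top hu.2.ne
  have h1 := sq_lintegral_le (volume.restrict c.dom)
    (hum.comp c.lipschitz_toFun.continuous.measurable).enorm.aemeasurable
  rw [Measure.restrict_apply_univ] at h1
  intro htop
  simp only [Function.comp_apply, htop] at h1
  rw [ENNReal.top_pow two_ne_zero] at h1
  exact ENNReal.mul_ne_top c.volume_dom_ne_top h2 (top_le_iff.1 h1)

theorem lintegral_pow_four_ne_top (hΩ : IsOpen Ω) {u : R3 → ℝ}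
    {g : Fin 3 → R3 → ℝ} (hum : Measurable u) (hgm : ∀ i, Measurable (g i))
    (hu : MemLp u 2 (volume.restrict Ω)) (hg : ∀ i, MemLp (g i) 2 (volume.restrict Ω))
    (hug : ∀ i, IsWeakDeriv Ω (Pi.single i 1) u (g i)) :
    ∫⁻ x in c.toFun '' c.dom, ‖u x‖ₑ ^ 4 ≠ ∞ := by
  have hΦm := c.lipschitz_toFun.continuous.measurable
  have h := lintegral_pow_four_ne_top_of_segInt c.measurableSet_dom c.convex_dom
    c.volume_dom_ne_top (L := (c.K * c.D : ℝ≥0)) ENNReal.coe_ne_top (hum.comp hΦm)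
    (Finset.measurable_fun_sum _ fun i _ => ((hgm i).comp hΦm).enorm)
    (c.lintegral_enorm_comp_ne_top hum hu)
    (c.lintegral_sum_pow_ne_top hgm two_ne_zero (by exact_mod_cast hg))
    (c.ae_enorm_sub_le_segInt hΩ hum hgm hu hg hug)
  refine ne_top_of_le_ne_top ?_ (setLIntegral_image_le c.lipschitz_toFun (hum.enorm.pow_const 4))
  exact ENNReal.mul_ne_top (by simp) h

theorem exists_ae_enorm_le (hΩ : IsOpen Ω) {u : R3 → ℝ}
    {g : Fin 3 → R3 → ℝ} (hum : Measurable u) (hgm : ∀ i, Measurable (g i))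
    (hu : MemLp u 2 (volume.restrict Ω)) (hg : ∀ i, MemLp (g i) 2 (volume.restrict Ω))
    (hg4 : ∀ i, MemLp (g i) 4 (volume.restrict Ω))
    (hug : ∀ i, IsWeakDeriv Ω (Pi.single i 1) u (g i)) :
    ∃ M : ℝ≥0∞, M ≠ ∞ ∧ ∀ᵐ x ∂volume.restrict (c.toFun '' c.dom), ‖u x‖ₑ ≤ M := by
  have hΦm := c.lipschitz_toFun.continuous.measurable
  obtain ⟨M, hM, h⟩ := exists_ae_enorm_le_of_segInt c.measurableSet_dom c.convex_dom
    c.volume_dom_ne_top (L := (c.K * c.D : ℝ≥0)) ENNReal.coe_ne_top (hum.comp hΦm)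
    (Finset.measurable_fun_sum _ fun i _ => ((hgm i).comp hΦm).enorm)
    (c.lintegral_enorm_comp_ne_top hum hu)
    (c.lintegral_sum_pow_ne_top hgm four_ne_zero (by exact_mod_cast hg4))
    (c.ae_enorm_sub_le_segInt hΩ hum hgm hu hg hug)
  refine ⟨M, hM, ?_⟩
  have hac : volume.restrict (c.toFun '' c.dom) ≪ (volume.restrict c.dom).map c.toFun :=
    Measure.absolutelyContinuous_of_le_smul (restrict_image_le c.lipschitz_toFun c.dom)
  refine hac.ae_le ?_
  exact (ae_map_iff hΦm.aemeasurable (measurableSet_le hum.enorm measurable_const)).2 h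

end ConvexChart

/-- The chart given by a closed ball. -/
def ballChart {Ω : Set R3} (x : R3) (r : ℝ≥0) (h : Metric.closedBall x r ⊆ Ω) : ConvexChart Ω where
  dom := Metric.closedBall x r
  exhaust _ := Metric.closedBall x r
  toFun := id
  inv := id
  K := 1
  D := 2 * r
  isCompact_exhaust _ := isCompact_closedBall x r
  convex_exhaust _ := convex_closedBall x r
  monotone_exhaust _ _ _ := le_rfl
  iUnion_exhaust := Set.iUnion_const _
  convex_dom := convex_closedBall x r
  norm_sub_le y hy z hz := by
    rw [← dist_eq_norm]
    refine (dist_triangle_right z y x).trans ?_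
    rw [Metric.mem_closedBall] at hy hz
    push_cast
    linarith
  lipschitz_toFun := LipschitzWith.id
  lipschitz_inv := LipschitzWith.id
  leftInvOn _ _ := rfl
  image_subset := by simpa using h

theorem convex_norm_le_inter_coord (s : Set ℝ) (hs : Convex ℝ s) :
    Convex ℝ {y : R3 | ‖y‖ ≤ 1 ∧ y 2 ∈ s} := by
  have h1 : Convex ℝ {y : R3 | ‖y‖ ≤ 1} := by
    have := convex_closedBall (0 : R3) 1
    simpa [Metric.closedBall, dist_zero_right] using this
  exact h1.inter (hs.linear_preimage (EuclideanSpace.proj (𝕜 := ℝ) (2 : Fin 3)).toLinearMap)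

/-- The chart given by a bi-Lipschitz parametrization of the half ball. -/
def halfBallChart {Ω : Set R3} {Φ Ψ : R3 → R3} {K : ℝ≥0} (hΦ : LipschitzWith K Φ)
    (hΨ : LipschitzWith K Ψ) (hinv : Set.LeftInvOn Ψ Φ {y | ‖y‖ ≤ 1 ∧ y 2 ∈ Set.Ioi (0 : ℝ)})
    (himage : Φ '' {y | ‖y‖ ≤ 1 ∧ y 2 ∈ Set.Ioi (0 : ℝ)} ⊆ Ω) : ConvexChart Ω where
  dom := {y | ‖y‖ ≤ 1 ∧ y 2 ∈ Set.Ioi (0 : ℝ)}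
  -- Staying at height at least `1 / (n + 1)` above the flat face makes the piece compact, with
  -- image inside the open set `Ω`.
  exhaust n := {y | ‖y‖ ≤ 1 ∧ y 2 ∈ Set.Ici (1 / (n + 1) : ℝ)}
  toFun := Φ
  inv := Ψ
  K := K
  D := 2
  isCompact_exhaust n := by
    have h1 : IsCompact {y : R3 | ‖y‖ ≤ 1} := by
      have := isCompact_closedBall (0 : R3) 1
      simpa [Metric.closedBall, dist_zero_right] using this
    exact h1.inter_right
      (isClosed_Ici.preimage (EuclideanSpace.proj (𝕜 := ℝ) (2 : Fin 3)).continuous)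
  convex_exhaust n := convex_norm_le_inter_coord _ (convex_Ici _)
  monotone_exhaust m n hmn y hy := ⟨hy.1, (Set.mem_Ici.1 hy.2).trans' (Nat.one_div_le_one_div hmn)⟩
  iUnion_exhaust := by
    ext y
    simp only [Set.mem_iUnion, Set.mem_ofPred_eq, Set.mem_Ici, Set.mem_Ioi]
    constructor
    · rintro ⟨n, h1, h2⟩
      exact ⟨h1, lt_of_lt_of_le Nat.one_div_pos_of_nat h2⟩
    · rintro ⟨h1, h2⟩
      obtain ⟨n, hn⟩ := exists_nat_one_div_lt h2
      exact ⟨n, h1, hn.le⟩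
  convex_dom := convex_norm_le_inter_coord _ (convex_Ioi _)
  norm_sub_le x hx y hy := by
    refine (norm_sub_le y x).trans ?_
    have h1 := hx.1
    have h2 := hy.1
    push_cast
    linarith
  lipschitz_toFun := hΦ
  lipschitz_inv := hΨ
  leftInvOn := hinv
  image_subset := himage

/-- Only the flat face meets `frontier Ω`: by injectivity, points with `y₃ > 0` map into `Ω`, and
every point of `U m ∩ Ω` comes from such a point. The maps are first extended to Lipschitz maps of
the whole space. -/
theorem HasLipschitzBoundary.exists_chart {Ω : Set R3} (hΩ : IsOpen Ω)
    (h : HasLipschitzBoundary Ω) : ∃ (M : ℕ) (U : Fin M → Set R3), (∀ m, IsOpen (U m)) ∧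
      frontier Ω ⊆ ⋃ m, U m ∧
      ∀ m, ∃ c : ConvexChart Ω, U m ∩ Ω ⊆ c.toFun '' c.dom := by
  obtain ⟨M, U, hU, hcov, K, hK⟩ := h
  refine ⟨M, U, hU, hcov, fun m => ?_⟩
  obtain ⟨Φ, Ψ, hΦ, hΨ, hinv, him, hflat⟩ := hK m
  obtain ⟨Φ', hΦ', hΦe⟩ := hΦ.extend_finite_dimension
  obtain ⟨Ψ', hΨ', hΨe⟩ := hΨ.extend_finite_dimension
  have hsub : {y : R3 | ‖y‖ ≤ 1 ∧ y 2 ∈ Set.Ioi (0 : ℝ)} ⊆ hemisphere :=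
    fun y hy => ⟨hy.1, le_of_lt hy.2⟩
  have hmem : ∀ y ∈ hemisphere, Φ y ∈ closure (U m) ∩ closure Ω := fun y hy =>
    him ▸ Set.mem_image_of_mem Φ hy
  refine ⟨halfBallChart hΦ' hΨ' ?_ ?_, ?_⟩
  · intro y hy
    rw [← hΦe (hsub hy), ← hΨe (hmem y (hsub hy))]
    exact hinv (hsub hy)
  · rintro _ ⟨y, hy, rfl⟩
    rw [← hΦe (hsub hy)]
    have h1 := hmem y (hsub hy)
    by_contra hn
    have h2 : Φ y ∈ closure (U m) ∩ frontier Ω := ⟨h1.1, h1.2, by rwa [hΩ.interior_eq]⟩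
    rw [← hflat] at h2
    obtain ⟨z, hz, hzy⟩ := h2
    have hz' : z ∈ hemisphere := ⟨hz.1, hz.2.ge⟩
    have : z = y := hinv.injOn hz' (hsub hy) hzy
    subst this
    exact (lt_irrefl (0 : ℝ)) (hz.2 ▸ hy.2)
  · rintro x ⟨hxU, hxΩ⟩
    have hx : x ∈ closure (U m) ∩ closure Ω := ⟨subset_closure hxU, subset_closure hxΩ⟩
    rw [← him] at hx
    obtain ⟨y, hy, rfl⟩ := hx
    have hpos : 0 < y 2 := lt_of_le_of_ne hy.2 fun h0 => by
      have hyf : y ∈ flatFace := ⟨hy.1, h0.symm⟩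
      have h2 : Φ y ∈ closure (U m) ∩ frontier Ω := hflat ▸ Set.mem_image_of_mem Φ hyf
      exact h2.2.2 (by rwa [hΩ.interior_eq])
    have hdom : y ∈ {y : R3 | ‖y‖ ≤ 1 ∧ y 2 ∈ Set.Ioi (0 : ℝ)} := ⟨hy.1, hpos⟩
    exact ⟨y, hdom, (hΦe hy).symm⟩

/-- What the boundary charts miss of `closure Ω` is compact and contained in `Ω`, so finitely many
balls cover it. -/
theorem IsBoundedLipschitzDomain.exists_atlas {Ω : Set R3} (hΩ : IsBoundedLipschitzDomain Ω) :
    ∃ T : Set (ConvexChart Ω), T.Finite ∧ Ω ⊆ ⋃ c ∈ T, c.toFun '' c.dom := by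
  obtain ⟨M, U, hU, hcov, hc⟩ := hΩ.lipschitz.exists_chart hΩ.isOpen
  choose c hc using hc
  have hZ : IsCompact (closure Ω \ ⋃ m, U m) :=
    hΩ.isBounded.isCompact_closure.diff (isOpen_iUnion hU)
  have hZΩ : closure Ω \ ⋃ m, U m ⊆ Ω := by
    rintro x ⟨hx, hxU⟩
    by_contra hn
    exact hxU (hcov ⟨hx, by rwa [hΩ.isOpen.interior_eq]⟩)
  have hball : ∀ x ∈ Ω, ∃ b : ConvexChart Ω, b.toFun '' b.dom ∈ 𝓝 x := by
    intro x hx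
    obtain ⟨r, hr, hrΩ⟩ := Metric.nhds_basis_closedBall.mem_iff.1 (hΩ.isOpen.mem_nhds hx)
    refine ⟨ballChart x ⟨r, hr.le⟩ hrΩ, ?_⟩
    change id '' Metric.closedBall x r ∈ 𝓝 x
    rw [Set.image_id]
    exact Metric.closedBall_mem_nhds x hr
  obtain ⟨x₀, hx₀⟩ := hΩ.isConnected.nonempty
  have : Nonempty (ConvexChart Ω) := ⟨(hball x₀ hx₀).choose⟩
  choose! b hb using hball
  obtain ⟨t, ht, htcov⟩ := hZ.elim_nhds_subcover (fun x => (b x).toFun '' (b x).dom)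
    fun x hx => hb x (hZΩ hx)
  refine ⟨Set.range c ∪ b '' t, (Set.finite_range c).union (t.finite_toSet.image b), fun x hx => ?_⟩
  by_cases hxU : x ∈ ⋃ m, U m
  · obtain ⟨m, hm⟩ := Set.mem_iUnion.1 hxU
    exact Set.mem_biUnion (.inl ⟨m, rfl⟩) (hc m ⟨hm, hx⟩)
  · obtain ⟨y, hy, hxy⟩ := Set.mem_iUnion₂.1 (htcov ⟨subset_closure hx, hxU⟩)
    exact Set.mem_biUnion (.inr ⟨y, hy, rfl⟩) hxy

/-! ### Sobolev embeddings on `Ω` -/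

/-- Functions with weak gradient in `L²` have measurable representatives with the same properties. -/
theorem exists_measurable_representative {Ω : Set R3} {u : R3 → ℝ} {g : Fin 3 → R3 → ℝ}
    (hu : MemLp u 2 (volume.restrict Ω)) (hg : ∀ i, MemLp (g i) 2 (volume.restrict Ω))
    (hug : ∀ i, IsWeakDeriv Ω (Pi.single i 1) u (g i)) :
    ∃ (u' : R3 → ℝ) (g' : Fin 3 → R3 → ℝ), Measurable u' ∧ (∀ i, Measurable (g' i)) ∧
      u =ᵐ[volume.restrict Ω] u' ∧ (∀ i, g i =ᵐ[volume.restrict Ω] g' i) ∧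
      ∀ i, IsWeakDeriv Ω (Pi.single i 1) u' (g' i) := by
  have hum := hu.aestronglyMeasurable
  have hgm := fun i => (hg i).aestronglyMeasurable
  exact ⟨hum.mk u, fun i => (hgm i).mk (g i), hum.stronglyMeasurable_mk.measurable,
    fun i => (hgm i).stronglyMeasurable_mk.measurable, hum.ae_eq_mk, fun i => (hgm i).ae_eq_mk,
    fun i => (hug i).congr_ae hum.ae_eq_mk (hgm i).ae_eq_mk
      (locallyIntegrableOn_of_memLp ((memLp_congr_ae hum.ae_eq_mk).1 hu))
      (locallyIntegrableOn_of_memLp ((memLp_congr_ae (hgm i).ae_eq_mk).1 (hg i)))⟩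

/-- The Sobolev embedding of functions with square-integrable weak gradient into `L⁴`. -/
theorem memLp_four_of_weakDeriv {Ω : Set R3} (hΩ : IsBoundedLipschitzDomain Ω) {u : R3 → ℝ}
    {g : Fin 3 → R3 → ℝ} (hu : MemLp u 2 (volume.restrict Ω))
    (hg : ∀ i, MemLp (g i) 2 (volume.restrict Ω))
    (hug : ∀ i, IsWeakDeriv Ω (Pi.single i 1) u (g i)) : MemLp u 4 (volume.restrict Ω) := by
  obtain ⟨v, h, hvm, hhm, huv, hgh, hvh⟩ := exists_measurable_representative hu hg hug
  obtain ⟨T, hT, hcov⟩ := hΩ.exists_atlas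
  refine (memLp_congr_ae huv).2 ⟨hvm.aestronglyMeasurable, ?_⟩
  have hsum : ∫⁻ x in Ω, ‖v x‖ₑ ^ 4 ≠ ∞ := by
    have := hT.fintype
    rw [Set.biUnion_eq_iUnion] at hcov
    have hle := (lintegral_mono_set (μ := volume) (f := fun x => ‖v x‖ₑ ^ 4) hcov).trans
      (lintegral_iUnion_le _ _)
    rw [tsum_fintype] at hle
    refine ne_top_of_le_ne_top (ENNReal.sum_ne_top.2 fun c _ => ?_) hle
    exact c.1.lintegral_pow_four_ne_top hΩ.isOpen hvm hhm ((memLp_congr_ae huv).1 hu)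
      (fun i => (memLp_congr_ae (hgh i)).1 (hg i)) hvh
  rw [lintegral_enorm_pow_eq v four_ne_zero] at hsum
  rw [lt_top_iff_ne_top]
  intro htop
  apply hsum
  simp [htop]

/-- Functions with weak gradient in `L⁴` are essentially bounded. -/
theorem memLp_top_of_weakDeriv {Ω : Set R3} (hΩ : IsBoundedLipschitzDomain Ω) {u : R3 → ℝ}
    {g : Fin 3 → R3 → ℝ} (hu : MemLp u 2 (volume.restrict Ω))
    (hg : ∀ i, MemLp (g i) 2 (volume.restrict Ω)) (hg4 : ∀ i, MemLp (g i) 4 (volume.restrict Ω))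
    (hug : ∀ i, IsWeakDeriv Ω (Pi.single i 1) u (g i)) : MemLp u ∞ (volume.restrict Ω) := by
  obtain ⟨v, h, hvm, hhm, huv, hgh, hvh⟩ := exists_measurable_representative hu hg hug
  obtain ⟨T, hT, hcov⟩ := hΩ.exists_atlas
  refine (memLp_congr_ae huv).2 ?_
  have hM : ∀ c : ConvexChart Ω, ∃ M : ℝ≥0∞, M ≠ ∞ ∧
      ∀ᵐ x ∂volume.restrict (c.toFun '' c.dom), ‖v x‖ₑ ≤ M := fun c =>
    c.exists_ae_enorm_le hΩ.isOpen hvm hhm ((memLp_congr_ae huv).1 hu)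
      (fun i => (memLp_congr_ae (hgh i)).1 (hg i)) (fun i => (memLp_congr_ae (hgh i)).1 (hg4 i)) hvh
  choose M hMt hM using hM
  -- The finite sum of the chart bounds serves as a common bound.
  have hae : ∀ᵐ x ∂volume.restrict Ω, ‖v x‖ₑ ≤ ∑ c ∈ hT.toFinset, M c := by
    refine ae_restrict_of_ae_restrict_of_subset hcov ?_
    rw [ae_restrict_biUnion_iff _ hT.countable]
    intro c hc
    filter_upwards [hM c] with x hx
    exact hx.trans (Finset.single_le_sum (f := M) (fun _ _ => zero_le) (hT.mem_toFinset.2 hc))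
  refine ⟨hvm.aestronglyMeasurable, ?_⟩
  rw [eLpNorm_exponent_top]
  refine (eLpNormEssSup_le_of_ae_enorm_bound hae).trans_lt ?_
  exact lt_top_iff_ne_top.2 (ENNReal.sum_ne_top.2 fun c _ => hMt c)

theorem memLp_four_of_memH_one {Ω : Set R3} (hΩ : IsBoundedLipschitzDomain Ω) {u : R3 → ℝ}
    (hu : MemH 1 Ω u) : MemLp u 4 (volume.restrict Ω) := by
  obtain ⟨h0, h⟩ := memH_succ_iff.1 hu
  choose g hg hg0 using h
  exact memLp_four_of_weakDeriv hΩ h0 (fun i => (hg0 i).1) hg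

theorem memLp_top_of_memH_two {Ω : Set R3} (hΩ : IsBoundedLipschitzDomain Ω) {u : R3 → ℝ}
    (hu : MemH 2 Ω u) : MemLp u ∞ (volume.restrict Ω) := by
  obtain ⟨h0, h⟩ := memH_succ_iff.1 hu
  choose g hg hg1 using h
  exact memLp_top_of_weakDeriv hΩ h0 (fun i => (hg1 i).1)
    (fun i => memLp_four_of_memH_one hΩ (hg1 i)) hg

/-- Either one factor is in `H² ⊆ L^∞` and the other in `L²`, or `a = b = 1` and both are in `L⁴`.
-/
theorem memLp_mul_of_memH {Ω : Set R3} (hΩ : IsBoundedLipschitzDomain Ω) {u v : R3 → ℝ} {a b : ℕ}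
    (hab : 2 ≤ a + b) (hu : MemH a Ω u) (hv : MemH b Ω v) :
    MemLp (u * v) 2 (volume.restrict Ω) := by
  by_cases ha : 2 ≤ a
  · exact hv.1.mul' (memLp_top_of_memH_two hΩ (memH_of_le ha hu))
  by_cases hb : 2 ≤ b
  · exact (memLp_top_of_memH_two hΩ (memH_of_le hb hv)).mul' hu.1
  have : ENNReal.HolderTriple 4 4 2 := ⟨by
    rw [← two_mul, show (4 : ℝ≥0∞) = 2 * 2 by norm_num,
      ENNReal.mul_inv (by norm_num) (by norm_num), ← mul_assoc,
      ENNReal.mul_inv_cancel (by norm_num) (by norm_num), one_mul]⟩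
  exact (memLp_four_of_memH_one hΩ (memH_of_le (by omega) hv)).mul'
    (memLp_four_of_memH_one hΩ (memH_of_le (by omega) hu))

/-! ### The weak product rule -/

theorem lintegral_mul_le_of_sq_le {α : Type*} [MeasurableSpace α] {μ : Measure α}
    {f g : α → ℝ≥0∞} (hf : AEMeasurable f μ) (hg : AEMeasurable g μ) {ε : ℝ≥0∞}
    (h : ∫⁻ x, f x ^ 2 ∂μ ≤ ε ^ 2) :
    ∫⁻ x, f x * g x ∂μ ≤ ε * (∫⁻ x, g x ^ 2 ∂μ + 1) := by
  have h1 := ENNReal.lintegral_mul_le_Lp_mul_Lq μ Real.HolderConjugate.two_two hf hg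
  have h2 := pow_le_pow_left₀ zero_le h1 2
  rw [mul_pow, ← ENNReal.rpow_natCast, ← ENNReal.rpow_natCast, ← ENNReal.rpow_natCast,
    ← ENNReal.rpow_mul, ← ENNReal.rpow_mul] at h2
  norm_num at h2
  refine (ENNReal.pow_le_pow_left_iff (n := 2) (by norm_num)).1 (h2.trans ?_)
  rw [mul_pow]
  gcongr
  exact le_self_add.trans (le_self_pow (by simp) (by norm_num))

theorem partialDeriv_mul {w φ : R3 → ℝ} (hw : ContDiff ℝ (⊤ : ℕ∞) w)
    (hφ : ContDiff ℝ (⊤ : ℕ∞) φ) (i : Fin 3) (x : R3) :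
    partialDeriv i (fun x => w x * φ x) x = w x * partialDeriv i φ x + partialDeriv i w x * φ x := by
  have h := ((hw.differentiable (by simp) x).hasFDerivAt.mul
    (hφ.differentiable (by simp) x).hasFDerivAt).fderiv
  simp only [partialDeriv]
  rw [show (fun x => w x * φ x) = w * φ from rfl, h]
  simp [mul_comm]

theorem IsTestFunction.mul_left {Ω : Set R3} {w φ : R3 → ℝ} (hw : ContDiff ℝ (⊤ : ℕ∞) w)
    (hφ : IsTestFunction Ω φ) : IsTestFunction Ω fun x => w x * φ x :=
  ⟨hw.mul hφ.1, hφ.2.1.mul_left, (tsupport_mul_subset_right).trans hφ.2.2⟩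

theorem IsTestFunction.memLp_mul {Ω : Set R3} {v φ : R3 → ℝ} (hφ : IsTestFunction Ω φ)
    (hv : MemLp v 2 (volume.restrict Ω)) :
    MemLp (fun x => v x * φ x) 2 (volume.restrict Ω) :=
  ((hφ.1.continuous.memLp_of_hasCompactSupport (p := ∞) hφ.2.1).restrict Ω).mul' hv

/-- The product rule for weak derivatives. -/
theorem IsWeakDeriv.mul {Ω : Set R3} (hΩ : IsOpen Ω) {u v h : R3 → ℝ} {g : Fin 3 → R3 → ℝ}
    (hu : MemLp u 2 (volume.restrict Ω)) (hg : ∀ i, MemLp (g i) 2 (volume.restrict Ω))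
    (hug : ∀ i, IsWeakDeriv Ω (Pi.single i 1) u (g i)) (hv : MemLp v 2 (volume.restrict Ω))
    (hh : MemLp h 2 (volume.restrict Ω)) {i : Fin 3} (hvh : IsWeakDeriv Ω (Pi.single i 1) v h) :
    IsWeakDeriv Ω (Pi.single i 1) (u * v) (g i * v + u * h) := by
  refine ⟨locallyIntegrableOn_of_locallyIntegrable_restrict (hu.integrable_mul hv).locallyIntegrable,
    locallyIntegrableOn_of_locallyIntegrable_restrict
      (((hg i).integrable_mul hv).add (hu.integrable_mul hh)).locallyIntegrable, fun φ hφ => ?_⟩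
  rw [multiDeriv_single, multiOrder_single]
  set ψ := partialDeriv i φ with hψdef
  have hψ : IsTestFunction Ω ψ := hφ.partialDeriv i
  set a : R3 → ℝ := fun x => v x * ψ x + h x * φ x with ha
  set b : R3 → ℝ := fun x => v x * φ x with hb
  have ha2 : MemLp a 2 (volume.restrict Ω) := (hψ.memLp_mul hv).add (hφ.memLp_mul hh)
  have hb2 : MemLp b 2 (volume.restrict Ω) := hφ.memLp_mul hv
  have hi1 : Integrable (fun x => u x * (v x * ψ x)) (volume.restrict Ω) :=
    hu.integrable_mul (hψ.memLp_mul hv)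
  have hi2 : Integrable (fun x => u x * (h x * φ x)) (volume.restrict Ω) :=
    hu.integrable_mul (hφ.memLp_mul hh)
  have hi3 : Integrable (fun x => g i x * (v x * φ x)) (volume.restrict Ω) :=
    (hg i).integrable_mul (hφ.memLp_mul hv)
  have hi4 : Integrable (fun x => u x * a x + g i x * b x) (volume.restrict Ω) :=
    (hu.integrable_mul ha2).add ((hg i).integrable_mul hb2)
  -- This is the product rule tested against `φ`, rearranged. Its left side is bounded by a finite
  -- constant times any `ε`.
  have hzero : ∫ x in Ω, (u x * a x + g i x * b x) = 0 := by
    rw [← enorm_eq_zero]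
    refine eq_zero_of_forall_le_mul
      (A := (∫⁻ x in Ω, ‖a x‖ₑ ^ 2) + 1 + ((∫⁻ x in Ω, ‖b x‖ₑ ^ 2) + 1)) ?_ fun ε hε => ?_
    · rw [lintegral_enorm_pow_eq a two_ne_zero, lintegral_enorm_pow_eq b two_ne_zero]
      have h1 := ENNReal.pow_ne_top (n := 2) ha2.2.ne
      have h2 := ENNReal.pow_ne_top (n := 2) hb2.2.ne
      exact ENNReal.add_ne_top.2 ⟨ENNReal.add_ne_top.2 ⟨h1, by simp⟩,
        ENNReal.add_ne_top.2 ⟨h2, by simp⟩⟩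
    · obtain ⟨w, hw, hw1, hw2⟩ := exists_contDiff_approx hΩ hφ.2.1.isCompact hφ.2.2 hu hg hug
        (pow_ne_zero 2 hε)
      -- With `w` a smooth approximation of `u` on the support of `φ`, `w φ` is admissible in the
      -- weak derivative of `v`. The identity holds exactly for `w`, so only the differences from
      -- `u` and `g i` remain.
      have hwφ : IsTestFunction Ω fun x => w x * φ x := hφ.mul_left hw
      have hz := hvh.2.2 _ hwφ
      rw [multiDeriv_single, multiOrder_single, pow_one, neg_one_mul, eq_neg_iff_add_eq_zero,
        ← integral_add ((hwφ.partialDeriv i).integrable_mul hv) (hwφ.integrable_mul hh)] at hz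
      have hzi : Integrable (fun x => v x * partialDeriv i (fun x => w x * φ x) x +
          h x * (w x * φ x)) (volume.restrict Ω) :=
        ((hwφ.partialDeriv i).integrable_mul hv).add (hwφ.integrable_mul hh)
      have hE : ∫ x in Ω, (u x * a x + g i x * b x) =
          ∫ x in Ω, ((u x - w x) * a x + (g i x - partialDeriv i w x) * b x) := by
        rw [← sub_zero (∫ x in Ω, (u x * a x + g i x * b x)), ← hz, ← integral_sub hi4 hzi]
        refine integral_congr_ae (.of_forall fun x => ?_)
        simp only [partialDeriv_mul hw hφ.1, ha, hb]
        ring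
      rw [hE]
      have hsupp : ∀ x, x ∉ tsupport φ → a x = 0 ∧ b x = 0 := by
        intro x hx
        have h1 : φ x = 0 := image_eq_zero_of_notMem_tsupport hx
        have h2 : ψ x = 0 := image_eq_zero_of_notMem_tsupport
          fun hx' => hx (tsupport_partialDeriv_subset φ i hx')
        simp [ha, hb, h1, h2]
      have hK : MeasurableSet (tsupport φ) := (isClosed_tsupport φ).measurableSet
      have hμ : volume.restrict (tsupport φ) ≤ volume.restrict Ω :=
        Measure.restrict_mono hφ.2.2 le_rfl
      have hum := (hu.aestronglyMeasurable.mono_measure hμ)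
      have hgm := ((hg i).aestronglyMeasurable.mono_measure hμ)
      have ham := (ha2.aestronglyMeasurable.mono_measure hμ).enorm
      have hbm := (hb2.aestronglyMeasurable.mono_measure hμ).enorm
      have hwm := hw.continuous.aestronglyMeasurable (μ := volume.restrict (tsupport φ))
      have hwdm := (contDiff_partialDeriv hw i).continuous.aestronglyMeasurable
        (μ := volume.restrict (tsupport φ))
      calc ‖∫ x in Ω, ((u x - w x) * a x + (g i x - partialDeriv i w x) * b x)‖ₑ
          ≤ ∫⁻ x in Ω, ‖(u x - w x) * a x + (g i x - partialDeriv i w x) * b x‖ₑ :=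
            enorm_integral_le_lintegral_enorm _
        _ ≤ ∫⁻ x in Ω, (tsupport φ).indicator
              (fun x => ‖w x - u x‖ₑ * ‖a x‖ₑ + ‖partialDeriv i w x - g i x‖ₑ * ‖b x‖ₑ) x := by
            refine lintegral_mono fun x => ?_
            by_cases hx : x ∈ tsupport φ
            · rw [Set.indicator_of_mem hx]
              refine (enorm_add_le _ _).trans (le_of_eq ?_)
              rw [enorm_mul, enorm_mul, enorm_sub_rev, enorm_sub_rev (g i x)]
            · simp [hsupp x hx]
        _ ≤ ∫⁻ x in tsupport φ,
              (‖w x - u x‖ₑ * ‖a x‖ₑ + ‖partialDeriv i w x - g i x‖ₑ * ‖b x‖ₑ) := by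
            rw [← lintegral_indicator hK]
            exact setLIntegral_le_lintegral _ _
        _ = (∫⁻ x in tsupport φ, ‖w x - u x‖ₑ * ‖a x‖ₑ) +
              ∫⁻ x in tsupport φ, ‖partialDeriv i w x - g i x‖ₑ * ‖b x‖ₑ :=
            lintegral_add_left' ((hwm.sub hum).enorm.mul ham) _
        _ ≤ ε * ((∫⁻ x in tsupport φ, ‖a x‖ₑ ^ 2) + 1) +
              ε * ((∫⁻ x in tsupport φ, ‖b x‖ₑ ^ 2) + 1) :=
            add_le_add (lintegral_mul_le_of_sq_le (hwm.sub hum).enorm ham hw1)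
              (lintegral_mul_le_of_sq_le (hwdm.sub hgm).enorm hbm (hw2 i))
        _ ≤ ε * ((∫⁻ x in Ω, ‖a x‖ₑ ^ 2) + 1) + ε * ((∫⁻ x in Ω, ‖b x‖ₑ ^ 2) + 1) := by
            gcongr ε * (?_ + 1) + ε * (?_ + 1)
            · exact lintegral_mono' hμ le_rfl
            · exact lintegral_mono' hμ le_rfl
        _ = _ := by ring
  have e1 : ∀ x, (u * v) x * ψ x = u x * (v x * ψ x) := fun x => mul_assoc _ _ _
  have e2 : ∀ x, (g i * v + u * h) x * φ x = g i x * (v x * φ x) + u x * (h x * φ x) := by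
    intro x
    simp only [Pi.add_apply, Pi.mul_apply]
    ring
  have e3 : ∀ x, u x * a x + g i x * b x =
      u x * (v x * ψ x) + (g i x * (v x * φ x) + u x * (h x * φ x)) := by
    intro x
    simp only [ha, hb]
    ring
  simp only [e1, e2]
  simp only [e3] at hzero
  have hi5 : Integrable (fun x => g i x * (v x * φ x) + u x * (h x * φ x)) (volume.restrict Ω) :=
    hi3.add hi2
  rw [integral_add hi1 hi5] at hzero
  linarith

/-! ### The algebra property and the inverse -/

/-- Products in the scale of Sobolev spaces `Hᵏ` on a bounded Lipschitz domain. -/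
theorem memH_mul_of_le {Ω : Set R3} (hΩ : IsBoundedLipschitzDomain Ω) {k : ℕ} :
    ∀ {a b : ℕ} {u v : R3 → ℝ}, k ≤ a → k ≤ b → k + 2 ≤ a + b → MemH a Ω u → MemH b Ω v →
      MemH k Ω (u * v) := by
  induction k with
  | zero =>
    intro a b u v _ _ hab hu hv
    exact memH_zero_iff.2 (memLp_mul_of_memH hΩ (by omega) hu hv)
  | succ k ih =>
    intro a b u v ha hb hab hu hv
    obtain ⟨a, rfl⟩ := Nat.exists_eq_add_of_le' (show 1 ≤ a by omega)
    obtain ⟨b, rfl⟩ := Nat.exists_eq_add_of_le' (show 1 ≤ b by omega)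
    refine memH_succ_iff.2 ⟨memLp_mul_of_memH hΩ (by omega) hu hv, fun i => ?_⟩
    choose g hg hga using (memH_succ_iff.1 hu).2
    choose h hh hhb using (memH_succ_iff.1 hv).2
    -- Each term of the product rule lowers one index by one, so `a + b` and `k` both drop by one
    -- and `k + 2 ≤ a + b` persists.
    exact ⟨_, IsWeakDeriv.mul hΩ.isOpen hu.1 (fun j => (hga j).1) hg hv.1 (hhb i).1 (hh i),
      (ih (by omega) (by omega) (by omega) (hga i) hv).add
        (ih (by omega) (by omega) (by omega) hu (hhb i))⟩

/-- `Hᵐ` is closed under products for `m ≥ 2`. -/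
theorem MemH.mul {Ω : Set R3} (hΩ : IsBoundedLipschitzDomain Ω) {m : ℕ} (hm : 2 ≤ m)
    {u v : R3 → ℝ} (hu : MemH m Ω u) (hv : MemH m Ω v) : MemH m Ω (u * v) :=
  memH_mul_of_le hΩ le_rfl le_rfl (by omega) hu hv

theorem MemH.zero {Ω : Set R3} (m : ℕ) : MemH m Ω 0 :=
  ⟨MemLp.zero, fun γ _ => ⟨0, ⟨locallyIntegrableOn_zero, locallyIntegrableOn_zero,
    fun φ _ => by simp⟩, MemLp.zero⟩⟩

theorem tensorMemH_adjugate {Ω : Set R3} (hΩ : IsBoundedLipschitzDomain Ω) {m : ℕ} (hm : 2 ≤ m)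
    {B : TensorField} (hB : TensorMemH m Ω B) : TensorMemH m Ω fun x => (B x).adjugate := by
  have hmin : ∀ i j k l i' j' k' l',
      MemH m Ω (fun x => B x i j * B x k l - B x i' j' * B x k' l') := by
    intro i j k l i' j' k' l'
    simp only [sub_eq_add_neg]
    exact ((hB i j).mul hΩ hm (hB k l)).add ((hB i' j').mul hΩ hm (hB k' l')).neg
  -- The explicit adjugate writes its minors with either sign pattern, so both shapes are needed.
  have hmin' : ∀ i j k l i' j' k' l',
      MemH m Ω (fun x => -(B x i j * B x k l) + B x i' j' * B x k' l') := fun i j k l i' j' k' l' =>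
    ((hB i j).mul hΩ hm (hB k l)).neg.add ((hB i' j').mul hΩ hm (hB k' l'))
  intro i j
  simp only [Matrix.adjugate_fin_three]
  fin_cases i <;> fin_cases j <;> first | exact hmin _ _ _ _ _ _ _ _ | exact hmin' _ _ _ _ _ _ _ _

/-- The inverse agrees with the adjugate almost everywhere on `Ω`, and membership in `Hᵐ` depends
only on the almost-everywhere class. -/
theorem tensorMemH_tensorInv {Ω : Set R3} (hΩ : IsBoundedLipschitzDomain Ω) {m : ℕ} (hm : 2 ≤ m)
    {B : TensorField} (hB : TensorMemH m Ω B)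
    (hdet : ∀ᵐ x ∂(volume.restrict Ω), (B x).det = 1) : TensorMemH m Ω (tensorInv B) := by
  intro i j
  refine (tensorMemH_adjugate hΩ hm hB i j).congr_ae ?_
  filter_upwards [hdet] with x hx
  simp [tensorInv, Matrix.inv_def, hx]

end Visco

theorem mainTheorem12 (Ω : Set Visco.R3) (hΩ : Visco.IsBoundedLipschitzDomain Ω)
    (m : ℕ) (hm : 2 ≤ m) (B : Visco.TensorField) (hB : Visco.TensorMemH m Ω B)
    (hdet : ∀ᵐ x ∂(volume.restrict Ω), (B x).det = 1) :
    Visco.TensorMemH m Ω (Visco.tensorInv B) ∧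
      ∀ μ₁ μ₂ μ₃ : Visco.R3 → ℝ,
        (Visco.MemW 1 ∞ Ω μ₁ ∧ Visco.MemH m Ω μ₁) →
        (Visco.MemW 1 ∞ Ω μ₂ ∧ Visco.MemH m Ω μ₂) →
        (Visco.MemW 1 ∞ Ω μ₃ ∧ Visco.MemH m Ω μ₃) →
        Visco.TensorMemH m Ω (Visco.calA μ₁ μ₂ μ₃ B) := by
  have hinv := Visco.tensorMemH_tensorInv hΩ hm hB hdet
  refine ⟨hinv, fun μ₁ μ₂ μ₃ h₁ h₂ h₃ i j => ?_⟩
  have hI : Visco.MemH m Ω fun x => μ₁ x * (1 : Matrix (Fin 3) (Fin 3) ℝ) i j := by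
    by_cases hij : i = j
    · subst hij
      simp only [Matrix.one_apply_eq, mul_one]
      exact h₁.2
    · simp only [Matrix.one_apply_ne hij, mul_zero]
      exact Visco.MemH.zero m
  exact (hI.add (h₂.2.mul hΩ hm (hB i j))).add (h₃.2.mul hΩ hm (hinv i j))
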